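/- Let $X$ be a random variable with values in $\{0,1,2,\ldots\}$, mean $\mu$, variance $\sigma^2$ and probability generating function $X(z)=\sum_{j\ge0}\mathbb P(X=j)z^j$ of radius of convergence $r\in(1,\infty]$, and suppose that $|X(z)|<X(r_1)$ whenever $0<r_1<r$, $|z|=r_1$ and $z\ne r_1$. For integers $n,s\ge1$ let $A$ be the sum of $n$ independent copies of $X$, so that $A(z)=\mathbb E(z^A)=X(z)^n$ for $|z|<r$, and define $\gamma$ by $$\frac{n\mu}{s}=1-\frac{\gamma}{\sqrt s}.$$ Let $Q(z)$ be the probability generating function of the stationary distribution of the Markov chain $Q_{m+1}=\max\{Q_m+A_m-s,0\}$, where $A_1,A_2,\ldots$ are independent copies of $A$; denote its meromorphic continuation to $|z|<r$ also by $Q$. Let $Z_0>1$ be the smallest modulus of a zero of $z^s-A(z)$ in $1<|z|<r$. For $k\in\mathbb Z$ let $Z_k$ be the zero of $z^s-A(z)$ in $1<|z|<r$ near $1$ that satisfies $$s\ln Z_k=n\ln X(Z_k)+2\pi i k$$ (principal logarithms; if there are several such zeros, the one nearest to $1$; for $k=0$ and large $s$ this is the number $Z_0$ above), and let $c_k$ be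 the residue of $Q$ at $Z_k$. Let $b_0=\gamma\sqrt{\mu}/(\sigma\sqrt2)$ and, for $0<\varepsilon<Z_0-1$, let $$I(Z)=\frac1{2\pi i}\int_{|z|=1+\varepsilon}\frac{\ln\bigl(1-z^{-s}A(z)\bigr)}{Z-z}\,dz .$$ Then, for bounded $k\in\mathbb Z$ and as $s\to\infty$ with $\gamma>0$ bounded away from $0$ and $\infty$, $$\frac{c_k}{1-Z_k}=\frac{\exp\bigl(I(Z_k)-I(1)\bigr)}{2\sqrt{b_0^2-2\pi ik}\,\bigl(b_0+\sqrt{b_0^2-2\pi ik}\bigr)}\bigl(1+O(s^{-1/2})\bigr)$$ with principal square roots. That is: for all $0<\gamma_1\le\gamma_2$ and $K\in\mathbb N$ there are $C$ and $s_0$, depending only on the law of $X$, $\gamma_1$, $\gamma_2$ and $K$, such that for all $s\ge s_0$ and all $n$ with $\gamma\in[\gamma_1,\gamma_2]$, all $|k|\le K$ and all $\varepsilon\in(0,Z_0-1)$, the identity holds with $1+E$ in place of $1+O(s^{-1/2})$ for some $E\in\mathbb C$ with $|E|\le C s^{-1/2}$. -/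

import Mathlib

open scoped Topology

noncomputable section

/-- The probability generating function `∑ⱼ p(j) zʲ` of a law on `ℕ`. -/
def pgf (p : PMF ℕ) (z : ℂ) : ℂ :=
  ∑' j : ℕ, ((p j).toReal : ℂ) * z ^ j

/-- The radius of convergence of the power series `∑ⱼ p(j) zʲ`. -/
def pgfRadius (p : PMF ℕ) : ENNReal :=
  (FormalMultilinearSeries.ofScalars ℂ (fun j : ℕ => ((p j).toReal : ℂ))).radius

/-- The mean of a law on `ℕ`. -/
def lawMean (p : PMF ℕ) : ℝ :=
  ∑' j : ℕ, (p j).toReal * (j : ℝ)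

/-- The variance of a law on `ℕ`. -/
def lawVariance (p : PMF ℕ) : ℝ :=
  ∑' j : ℕ, (p j).toReal * ((j : ℝ) - lawMean p) ^ 2

/-- The law of the sum of `n` independent random variables with law `p`: the demand per period
of `n` sources. -/
def demandLaw (p : PMF ℕ) : ℕ → PMF ℕ
  | 0 => PMF.pure 0
  | n + 1 => (demandLaw p n).bind fun a => p.map fun x => a + x

/-- `q` is a stationary law of the queue-length chain `Q' = max (Q + A - s) 0`, where `A` is
independent of `Q` and has law `demandLaw p n`. Subtraction in `ℕ` is truncated at `0`, so that
`x + a - s` is `max (x + a - s) 0`. -/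
def IsStationaryLaw (p : PMF ℕ) (n s : ℕ) (q : PMF ℕ) : Prop :=
  (q.bind fun x => (demandLaw p n).map fun a => x + a - s) = q

/-- `F` is a meromorphic continuation, to the disk `|z| < r`, of the generating function of `q`
on the open unit disk. -/
structure IsMeromorphicContinuation (q : PMF ℕ) (r : ENNReal) (F : ℂ → ℂ) : Prop where
  meromorphic : ∀ z : ℂ, ENNReal.ofReal ‖z‖ < r → MeromorphicAt F z
  eq_pgf : ∀ z : ℂ, ‖z‖ < 1 → F z = pgf q z

/-- The residue of `F` at `w`: the common value of `(2πi)⁻¹ ∮ F` over all small circles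
around `w`. -/
def residueAt (F : ℂ → ℂ) (w : ℂ) : ℂ :=
  Filter.limUnder (𝓝[>] (0 : ℝ)) fun ρ : ℝ =>
    (2 * (Real.pi : ℂ) * Complex.I)⁻¹ * ∮ z in C(w, ρ), F z

/-- `w` is a zero of `zˢ - A(z)` in the annulus `1 < |z| < r`. -/
def IsOuterZero (p : PMF ℕ) (n s : ℕ) (w : ℂ) : Prop :=
  1 < ‖w‖ ∧ ENNReal.ofReal ‖w‖ < pgfRadius p ∧ w ^ s - pgf (demandLaw p n) w = 0

/-- `w` is a zero of `zˢ - A(z)` in the annulus `1 < |z| < r` that lies on the `k`-th branch,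
`s ln w = n ln X(w) + 2πik`, of the equation `zˢ = X(z)ⁿ` (principal logarithms). -/
def IsOuterZeroOnBranch (p : PMF ℕ) (n s : ℕ) (k : ℤ) (w : ℂ) : Prop :=
  IsOuterZero p n s w ∧
    (s : ℂ) * Complex.log w =
      (n : ℂ) * Complex.log (pgf p w) + 2 * (Real.pi : ℂ) * Complex.I * (k : ℂ)

/-- `Z` is the outer zero `Z_k`: the zero of `zˢ - A(z)` in `1 < |z| < r` on the `k`-th branch
that is near `1`, i.e. nearest to `1` among the outer zeros on that branch. -/
def IsOuterZeroOfIndex (p : PMF ℕ) (n s : ℕ) (k : ℤ) (Z : ℂ) : Prop :=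
  IsOuterZeroOnBranch p n s k Z ∧
    ∀ w : ℂ, IsOuterZeroOnBranch p n s k w → ‖Z - 1‖ ≤ ‖w - 1‖

/-- The contour integral `I(Z) = (2πi)⁻¹ ∮_{|z| = 1 + ε} ln (1 - z⁻ˢ A(z)) / (Z - z) dz`. -/
def contourI (p : PMF ℕ) (n s : ℕ) (ε : ℝ) (Z : ℂ) : ℂ :=
  (2 * (Real.pi : ℂ) * Complex.I)⁻¹ *
    ∮ z in C(0, 1 + ε), Complex.log (1 - (z ^ s)⁻¹ * pgf (demandLaw p n) z) / (Z - z)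

/-- `b₀ = γ √μ / (σ √2)`. -/
def bZero (p : PMF ℕ) (γ : ℝ) : ℝ :=
  γ * √(lawMean p) / (√(lawVariance p) * √2)

/-- The principal square root of `b₀² - 2πik`. -/
def rootK (p : PMF ℕ) (γ : ℝ) (k : ℤ) : ℂ :=
  ((bZero p γ : ℂ) ^ 2 - 2 * (Real.pi : ℂ) * Complex.I * (k : ℂ)) ^ (1 / 2 : ℂ)

end

/-! ### Probability generating functions -/

/-! An exact formula is followed by an asymptotic estimate. Let D(z) = zˢ - X(z)ⁿ. Stationarity
gives Q D = N, where the polynomial N has degree at most s and is built from the mass of Q + A below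
s. In 1 ≤ |z| < Z₀ the only zero of D is the simple one at 1, which is also a zero of N, so Q
extends holomorphically to |z| < Z₀ with Q(1) = 1. On 1 < |z| < Z₀ this reads z⁻ˢ N = Q exp(ln(1 -
z⁻ˢA)), and z⁻ˢ N is bounded on |z| > 1. Cauchy's formula splits the logarithm into a part
holomorphic inside and a part holomorphic outside; moving one part to each side glues the two sides
into a bounded entire function, and Liouville's theorem gives N(Z) = Zˢ exp(I(Z) - I(1))
(`wienerHopf_eq`, `boundaryPoly_eq_exp_contourI`). Dividing by D'(Z_k) shows that c_k/(1 - Z_k) is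
exactly exp(I(Z_k) - I(1)) over (1 - Z_k)(s/Z_k - nX'(Z_k)/X(Z_k)).

Only this denominator is estimated (`exists_outerZero_estimate`). Put ln Z = Aδy with δ = s^(-1/2)
and A = √(2μ)/σ. The cumulant expansion turns the branch equation into 2b₀y - y² = 2πik up to
O(δ|y|²), with limiting roots b₀ ± w, w² = b₀² - 2πik. Since |Z| > 1 means Re y > 0 while Re(b₀ - w)
≤ 0, it follows that y = b₀ + w + O(δ). The denominator is 2y² - 2b₀y + O(δ) = 2w(b₀ + w) + O(δ).

Two points need care. Z_k is only known to be nearest to 1, so a zero near b₀ + w must first be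
produced to bound y (`exists_zero_of_near_quadratic`). For k = 0 the spurious root y = 0, that is Z
= 1, lies on the edge of the half plane; it is excluded because the error carries |y|², so that a
factor |y| can be cancelled (`norm_sub_root_le`). -/

theorem summable_pgf_of_lt_radius {p : PMF ℕ} {x : ℝ} (hx : 0 ≤ x)
    (h : ENNReal.ofReal x < pgfRadius p) : Summable fun j => (p j).toReal * x ^ j := by
  lift x to NNReal using hx
  rw [ENNReal.ofReal_coe_nnreal] at h
  refine (FormalMultilinearSeries.summable_norm_mul_pow _ h).congr fun j => ?_
  rw [FormalMultilinearSeries.ofScalars_norm]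
  simp

theorem exists_real_between_radius {p : PMF ℕ} {x : ℝ} (h : ENNReal.ofReal x < pgfRadius p) :
    ∃ R : ℝ, x < R ∧ 0 < R ∧ ENNReal.ofReal R < pgfRadius p := by
  obtain ⟨c, hc1, hc2⟩ := exists_between h
  have hct : c ≠ ⊤ := ne_top_of_lt hc2
  have hc0 : c ≠ 0 := (bot_le.trans_lt hc1).ne'
  refine ⟨c.toReal, ?_, ENNReal.toReal_pos hc0 hct, ?_⟩
  · by_contra! hcon
    exact (ENNReal.le_ofReal_iff_toReal_le hct (ENNReal.toReal_nonneg.trans hcon)).2 hcon |>.not_gt hc1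
  · rwa [ENNReal.ofReal_toReal hct]

/-- Arbitrary exponents `e` make the result applicable to its own output, whose exponents are `j -
1`; this yields the second derivative. -/
theorem hasSum_deriv_tsum_mul_pow {a : ℕ → ℂ} {e : ℕ → ℕ} {R : ℝ}
    (h : ∀ x, 0 ≤ x → x < R → Summable fun j => ‖a j‖ * x ^ e j) {z : ℂ} (hz : ‖z‖ < R) :
    HasSum (fun j => a j * e j * z ^ (e j - 1)) (deriv (fun w => ∑' j, a j * w ^ e j) z) := by
  obtain ⟨x, hx1, hx2⟩ := exists_between hz
  have := Complex.hasSum_deriv_of_summable_norm (F := fun j w => a j * w ^ e j)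
    (U := Metric.ball (0 : ℂ) x) (h x ((norm_nonneg z).trans hx1.le) hx2)
    (fun i => by fun_prop) Metric.isOpen_ball (fun i w hw => ?_)
    (show z ∈ Metric.ball 0 x by simpa using hx1)
  · simpa [mul_assoc] using this
  · rw [norm_mul, norm_pow]
    have : ‖w‖ < x := by simpa using hw
    gcongr

theorem differentiableOn_tsum_mul_pow {a : ℕ → ℂ} {e : ℕ → ℕ} {R : ℝ}
    (h : ∀ x, 0 ≤ x → x < R → Summable fun j => ‖a j‖ * x ^ e j) :
    DifferentiableOn ℂ (fun w => ∑' j, a j * w ^ e j) (Metric.ball 0 R) := by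
  intro z hz
  obtain ⟨x, hx1, hx2⟩ := exists_between (show ‖z‖ < R by simpa using hz)
  have := Complex.differentiableOn_tsum_of_summable_norm (F := fun j w => a j * w ^ e j)
    (U := Metric.ball (0 : ℂ) x) (h x ((norm_nonneg z).trans hx1.le) hx2)
    (fun i => by fun_prop) Metric.isOpen_ball (fun i w hw => ?_)
  · exact ((this z (by simpa using hx1)).differentiableAt
      (Metric.isOpen_ball.mem_nhds (by simpa using hx1))).differentiableWithinAt
  · rw [norm_mul, norm_pow]
    have : ‖w‖ < x := by simpa using hw
    gcongr

theorem summable_deriv_tsum_mul_pow {a : ℕ → ℂ} {e : ℕ → ℕ} {R : ℝ}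
    (h : ∀ x, 0 ≤ x → x < R → Summable fun j => ‖a j‖ * x ^ e j) (x : ℝ) (hx : 0 ≤ x)
    (hxR : x < R) : Summable fun j => ‖a j * e j‖ * x ^ (e j - 1) := by
  have := (hasSum_deriv_tsum_mul_pow h (z := (x : ℂ)) (by simpa [abs_of_nonneg hx])).summable.norm
  refine this.congr fun j => ?_
  rw [norm_mul, norm_pow, Complex.norm_real, Real.norm_of_nonneg hx]

section Basic

variable {p : PMF ℕ}

theorem summable_toReal (p : PMF ℕ) : Summable fun j => (p j).toReal :=
  ENNReal.summable_toReal p.tsum_coe_ne_top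

theorem tsum_toReal (p : PMF ℕ) : ∑' j, (p j).toReal = 1 := by
  rw [← ENNReal.tsum_toReal_eq fun j => p.apply_ne_top j, p.tsum_coe, ENNReal.toReal_one]

theorem summable_norm_pgf {R : ℝ} (hR : ENNReal.ofReal R < pgfRadius p) (x : ℝ) (hx : 0 ≤ x)
    (hxR : x < R) : Summable fun j => ‖((p j).toReal : ℂ)‖ * x ^ j := by
  refine (summable_pgf_of_lt_radius (p := p) hx
    ((ENNReal.ofReal_le_ofReal hxR.le).trans_lt hR)).congr fun j => ?_
  rw [Complex.norm_real, Real.norm_of_nonneg ENNReal.toReal_nonneg]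

theorem summable_norm_pgf_term {z : ℂ} (hz : ENNReal.ofReal ‖z‖ < pgfRadius p) :
    Summable fun j => ‖((p j).toReal : ℂ) * z ^ j‖ := by
  obtain ⟨R, h1, -, h2⟩ := exists_real_between_radius hz
  refine (summable_norm_pgf h2 _ (norm_nonneg z) h1).congr fun j => ?_
  rw [norm_mul, norm_pow]

theorem summable_norm_pgf_term_of_norm_le_one (p : PMF ℕ) {z : ℂ} (hz : ‖z‖ ≤ 1) :
    Summable fun j => ‖((p j).toReal : ℂ) * z ^ j‖ := by
  refine (summable_toReal p).of_nonneg_of_le (fun j => norm_nonneg _) fun j => ?_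
  rw [norm_mul, norm_pow, Complex.norm_real, Real.norm_of_nonneg ENNReal.toReal_nonneg]
  exact mul_le_of_le_one_right ENNReal.toReal_nonneg (pow_le_one₀ (norm_nonneg z) hz)

theorem pgf_one (p : PMF ℕ) : pgf p 1 = 1 := by
  have := congrArg (fun x : ℝ => (x : ℂ)) (tsum_toReal p)
  simpa [pgf, Complex.ofReal_tsum] using this

theorem pgf_ofReal (p : PMF ℕ) (x : ℝ) :
    pgf p (x : ℂ) = ((∑' j, (p j).toReal * x ^ j : ℝ) : ℂ) := by
  simp [pgf, Complex.ofReal_tsum]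

theorem norm_pgf_le {z : ℂ} (hz : ENNReal.ofReal ‖z‖ < pgfRadius p) :
    ‖pgf p z‖ ≤ (pgf p (‖z‖ : ℂ)).re := by
  rw [pgf_ofReal, Complex.ofReal_re]
  refine (norm_tsum_le_tsum_norm (summable_norm_pgf_term hz)).trans_eq (tsum_congr fun j => ?_)
  rw [norm_mul, norm_pow, Complex.norm_real, Real.norm_of_nonneg ENNReal.toReal_nonneg]

theorem differentiableAt_pgf {z : ℂ} (hz : ENNReal.ofReal ‖z‖ < pgfRadius p) :
    DifferentiableAt ℂ (pgf p) z := by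
  obtain ⟨R, h1, -, h2⟩ := exists_real_between_radius hz
  exact (differentiableOn_tsum_mul_pow (summable_norm_pgf h2)).differentiableAt
    (Metric.isOpen_ball.mem_nhds (by simpa using h1))

theorem isOpen_norm_lt_radius (p : PMF ℕ) :
    IsOpen {z : ℂ | ENNReal.ofReal ‖z‖ < pgfRadius p} :=
  isOpen_lt (ENNReal.continuous_ofReal.comp continuous_norm) continuous_const

theorem analyticAt_pgf {z : ℂ} (hz : ENNReal.ofReal ‖z‖ < pgfRadius p) :
    AnalyticAt ℂ (pgf p) z :=
  DifferentiableOn.analyticAt (s := {z : ℂ | ENNReal.ofReal ‖z‖ < pgfRadius p})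
    (fun _ hw => (differentiableAt_pgf hw).differentiableWithinAt)
    ((isOpen_norm_lt_radius p).mem_nhds hz)

/-! ### Generating functions of sums of independent variables -/

theorem toReal_bind_add (q d : PMF ℕ) (j : ℕ) :
    ((q.bind fun x => d.map fun a => x + a) j).toReal =
      ∑ x ∈ Finset.HasAntidiagonal.antidiagonal j, (q x.1).toReal * (d x.2).toReal := by
  have h1 : ∀ x, (d.map fun a => x + a) j = if x ≤ j then d (j - x) else 0 := by
    intro x
    rw [PMF.map_apply]
    split_ifs with h
    · rw [tsum_eq_single (j - x)]
      · rw [if_pos (by omega)]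
      · intro b hb
        rw [if_neg (by omega)]
    · simp only [ENNReal.tsum_eq_zero]
      intro b
      rw [if_neg (by omega)]
  rw [PMF.bind_apply, tsum_eq_sum (s := Finset.range (j + 1)),
    ENNReal.toReal_sum, Finset.Nat.sum_antidiagonal_eq_sum_range_succ_mk]
  · refine Finset.sum_congr rfl fun x hx => ?_
    rw [h1, if_pos (by simpa [Nat.lt_succ_iff] using hx), ENNReal.toReal_mul]
  · intro x hx
    rw [h1]
    split_ifs
    · exact ENNReal.mul_ne_top (q.apply_ne_top _) (d.apply_ne_top _)
    · simp
  · intro x hx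
    rw [h1, if_neg (by simpa [Nat.lt_succ_iff] using hx), mul_zero]

theorem pgf_term_bind_add (q d : PMF ℕ) (z : ℂ) (j : ℕ) :
    (((q.bind fun x => d.map fun a => x + a) j).toReal : ℂ) * z ^ j =
      ∑ x ∈ Finset.HasAntidiagonal.antidiagonal j,
        (((q x.1).toReal : ℂ) * z ^ x.1) * (((d x.2).toReal : ℂ) * z ^ x.2) := by
  rw [toReal_bind_add, Complex.ofReal_sum, Finset.sum_mul]
  refine Finset.sum_congr rfl fun x hx => ?_
  rw [← Finset.HasAntidiagonal.mem_antidiagonal.1 hx, pow_add]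
  push_cast
  ring

theorem pgf_bind_add (q d : PMF ℕ) {z : ℂ}
    (hq : Summable fun j => ‖((q j).toReal : ℂ) * z ^ j‖)
    (hd : Summable fun j => ‖((d j).toReal : ℂ) * z ^ j‖) :
    (Summable fun j => ‖(((q.bind fun x => d.map fun a => x + a) j).toReal : ℂ) * z ^ j‖) ∧
      pgf (q.bind fun x => d.map fun a => x + a) z = pgf q z * pgf d z := by
  have he := pgf_term_bind_add q d z
  refine ⟨(summable_norm_sum_mul_antidiagonal_of_summable_norm hq hd).congr fun j => by rw [he], ?_⟩
  rw [pgf, tsum_congr he]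
  exact (tsum_mul_tsum_eq_tsum_sum_antidiagonal_of_summable_norm hq hd).symm

theorem pgf_demandLaw_aux (p : PMF ℕ) (n : ℕ) {z : ℂ}
    (hp : Summable fun j => ‖((p j).toReal : ℂ) * z ^ j‖) :
    (Summable fun j => ‖((demandLaw p n j).toReal : ℂ) * z ^ j‖) ∧
      pgf (demandLaw p n) z = pgf p z ^ n := by
  induction n with
  | zero =>
    have h0 : ∀ j ≠ 0, ((demandLaw p 0 j).toReal : ℂ) * z ^ j = 0 := by
      intro j hj
      simp [demandLaw, PMF.pure_apply, hj]
    constructor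
    · refine summable_of_ne_finset_zero (s := {0}) fun j hj => ?_
      rw [h0 j (by simpa using hj), norm_zero]
    · rw [pgf, tsum_eq_single 0 h0]
      simp [demandLaw]
  | succ n ih =>
    obtain ⟨h1, h2⟩ := pgf_bind_add (demandLaw p n) p ih.1 hp
    exact ⟨h1, h2.trans (by rw [ih.2, pow_succ])⟩

theorem pgf_demandLaw (n : ℕ) {z : ℂ} (hz : ENNReal.ofReal ‖z‖ < pgfRadius p) :
    pgf (demandLaw p n) z = pgf p z ^ n :=
  (pgf_demandLaw_aux p n (summable_norm_pgf_term hz)).2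

theorem one_lt_radius_ofReal (hr : 1 < pgfRadius p) {z : ℂ} (hz : ‖z‖ ≤ 1) :
    ENNReal.ofReal ‖z‖ < pgfRadius p :=
  (ENNReal.ofReal_le_one.2 hz).trans_lt hr

/-! ### Mean and variance from derivatives at 1; nondegeneracy -/

theorem summable_moment_one (hr : 1 < pgfRadius p) :
    Summable fun j => (p j).toReal * (j : ℝ) := by
  obtain ⟨R, h1, -, h2⟩ := exists_real_between_radius (p := p) (x := 1) (by simpa using hr)
  refine (summable_deriv_tsum_mul_pow (summable_norm_pgf h2) 1 zero_le_one h1).congr fun j => ?_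
  simp

theorem deriv_pgf_one (hr : 1 < pgfRadius p) : deriv (pgf p) 1 = lawMean p := by
  obtain ⟨R, h1, -, h2⟩ := exists_real_between_radius (p := p) (x := 1) (by simpa using hr)
  have := hasSum_deriv_tsum_mul_pow (summable_norm_pgf h2) (z := 1) (by simpa using h1)
  change deriv (fun w => ∑' j, ((p j).toReal : ℂ) * w ^ j) 1 = _
  rw [← this.tsum_eq]
  simp [lawMean, Complex.ofReal_tsum]

theorem hasSum_deriv_deriv_pgf_one (hr : 1 < pgfRadius p) :
    HasSum (fun j : ℕ => ((p j).toReal : ℂ) * j * ((j - 1 : ℕ) : ℂ)) (deriv (deriv (pgf p)) 1) := by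
  obtain ⟨R, h1, -, h2⟩ := exists_real_between_radius (p := p) (x := 1) (by simpa using hr)
  have hs := summable_deriv_tsum_mul_pow (summable_norm_pgf h2)
  have := hasSum_deriv_tsum_mul_pow hs (z := 1) (by simpa using h1)
  have he : deriv (pgf p) =ᶠ[𝓝 1] fun w => ∑' j, ((p j).toReal : ℂ) * j * w ^ (j - 1) := by
    filter_upwards [Metric.isOpen_ball.mem_nhds (show (1 : ℂ) ∈ Metric.ball 0 R by simpa using h1)]
      with w hw
    exact (hasSum_deriv_tsum_mul_pow (summable_norm_pgf h2) (by simpa using hw)).tsum_eq.symm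
  rw [he.deriv_eq]
  simpa using this

theorem hasSum_variance (hr : 1 < pgfRadius p) :
    HasSum (fun j : ℕ => (((p j).toReal * ((j : ℝ) - lawMean p) ^ 2 : ℝ) : ℂ))
      (deriv (deriv (pgf p)) 1 + lawMean p - (lawMean p : ℂ) ^ 2) := by
  have h0 : HasSum (fun j => ((p j).toReal : ℂ)) 1 := by
    have h := (summable_toReal p).hasSum
    rw [tsum_toReal] at h
    simpa using Complex.hasSum_ofReal.2 h
  have h1 : HasSum (fun j => ((p j).toReal : ℂ) * j) (lawMean p) := by
    exact_mod_cast Complex.hasSum_ofReal.2 (summable_moment_one hr).hasSum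
  have h2 := hasSum_deriv_deriv_pgf_one hr
  have h := (h2.add (h1.mul_left (1 - 2 * (lawMean p : ℂ)))).add (h0.mul_left ((lawMean p : ℂ) ^ 2))
  convert h using 1
  -- The case `j = 0` is separate because `j - 1` is truncated there; the factor `j` makes the term
  -- vanish.
  · funext j
    rcases j with _ | j
    · push_cast; ring
    · push_cast [Nat.add_sub_cancel]; ring
  · ring

theorem deriv_deriv_pgf_one (hr : 1 < pgfRadius p) :
    deriv (deriv (pgf p)) 1 = lawVariance p - lawMean p + (lawMean p : ℂ) ^ 2 := by
  have := (hasSum_variance hr).tsum_eq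
  rw [← Complex.ofReal_tsum] at this
  change ((lawVariance p : ℝ) : ℂ) = _ at this
  rw [this]
  ring

/-- A point mass has |X(-1)| = 1 = X(1), which strict maximality on the unit circle forbids. -/
theorem exists_two_atoms (hr : 1 < pgfRadius p)
    (hmax : ∀ r₁ : ℝ, 0 < r₁ → ENNReal.ofReal r₁ < pgfRadius p →
      ∀ z : ℂ, ‖z‖ = r₁ → z ≠ (r₁ : ℂ) → ‖pgf p z‖ < (pgf p (r₁ : ℂ)).re) :
    ∃ i j, i ≠ j ∧ p i ≠ 0 ∧ p j ≠ 0 := by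
  by_contra! hcon
  obtain ⟨i, hi⟩ := p.support_nonempty
  have h0 : ∀ j ≠ i, p j = 0 := fun j hj => hcon i j hj.symm hi
  have h1 := hmax 1 one_pos (by simpa using hr) (-1) (by simp) (by norm_num)
  have h2 : ∀ z : ℂ, pgf p z = ((p i).toReal : ℂ) * z ^ i := fun z =>
    tsum_eq_single i fun j hj => by simp [h0 j hj]
  have h3 : ((p i).toReal : ℂ) = 1 := by simpa [pgf_one] using (h2 1).symm
  rw [h2, Complex.ofReal_one, pgf_one, h3] at h1
  simp at h1

theorem lawMean_pos (hr : 1 < pgfRadius p)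
    (hmax : ∀ r₁ : ℝ, 0 < r₁ → ENNReal.ofReal r₁ < pgfRadius p →
      ∀ z : ℂ, ‖z‖ = r₁ → z ≠ (r₁ : ℂ) → ‖pgf p z‖ < (pgf p (r₁ : ℂ)).re) :
    0 < lawMean p := by
  obtain ⟨i, j, hij, hi, hj⟩ := exists_two_atoms hr hmax
  obtain ⟨m, hm0, hm⟩ : ∃ m, m ≠ 0 ∧ p m ≠ 0 := by
    by_cases h : i = 0
    · exact ⟨j, by omega, hj⟩
    · exact ⟨i, h, hi⟩
  refine (summable_moment_one hr).tsum_pos (fun j => by positivity) m ?_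
  have := ENNReal.toReal_pos hm (p.apply_ne_top m)
  positivity

theorem lawVariance_pos (hr : 1 < pgfRadius p)
    (hmax : ∀ r₁ : ℝ, 0 < r₁ → ENNReal.ofReal r₁ < pgfRadius p →
      ∀ z : ℂ, ‖z‖ = r₁ → z ≠ (r₁ : ℂ) → ‖pgf p z‖ < (pgf p (r₁ : ℂ)).re) :
    0 < lawVariance p := by
  obtain ⟨i, j, hij, hi, hj⟩ := exists_two_atoms hr hmax
  obtain ⟨m, hm0, hm⟩ : ∃ m : ℕ, (m : ℝ) - lawMean p ≠ 0 ∧ p m ≠ 0 := by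
    by_cases h : (i : ℝ) - lawMean p = 0
    · refine ⟨j, fun h' => hij ?_, hj⟩
      exact_mod_cast (sub_eq_zero.1 h).trans (sub_eq_zero.1 h').symm
    · exact ⟨i, h, hi⟩
  refine (Complex.summable_ofReal.1 (hasSum_variance hr).summable).tsum_pos
    (fun j => by positivity) m ?_
  have := ENNReal.toReal_pos hm (p.apply_ne_top m)
  positivity

end Basic

/-! ### The functional equation of a stationary law -/

/-- The polynomial `∑_{j < s} b(j) (zˢ - zʲ)`. -/
noncomputable def boundaryPoly (b : PMF ℕ) (s : ℕ) (z : ℂ) : ℂ :=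
  ∑ j ∈ Finset.range s, ((b j).toReal : ℂ) * (z ^ s - z ^ j)

/-- Truncation shifts the mass by s and collects everything below s at 0. -/
theorem toReal_map_sub (b : PMF ℕ) (s j : ℕ) :
    ((b.map fun i => i - s) j).toReal =
      (b (j + s)).toReal + if j = 0 then ∑ i ∈ Finset.range s, (b i).toReal else 0 := by
  have hm : (b.map fun i => i - s) j = ∑' i, if j = i - s then b i else 0 := by
    rw [PMF.map_apply]
    congr!
  rw [hm, ← Summable.sum_add_tsum_nat_add' (k := s) ENNReal.summable]
  have h1 : ∑' i, (if j = i + s - s then b (i + s) else 0) = b (j + s) := by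
    rw [tsum_eq_single j]
    · simp
    · intro i hi
      rw [if_neg (by omega)]
  have h2 : ∑ i ∈ Finset.range s, (if j = i - s then b i else 0) =
      if j = 0 then ∑ i ∈ Finset.range s, b i else 0 := by
    split_ifs with h
    · refine Finset.sum_congr rfl fun i hi => ?_
      rw [if_pos (by have := Finset.mem_range.1 hi; omega)]
    · refine Finset.sum_eq_zero fun i hi => ?_
      rw [if_neg (by have := Finset.mem_range.1 hi; omega)]
  have h3 : ∑ i ∈ Finset.range s, b i ≠ ⊤ := by
    simpa [ENNReal.sum_eq_top] using fun i _ => b.apply_ne_top i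
  rw [h1, h2, add_comm, ENNReal.toReal_add (b.apply_ne_top _) (by split_ifs <;> simp [h3])]
  congr 1
  split_ifs
  · rw [ENNReal.toReal_sum fun i _ => b.apply_ne_top i]
  · rfl

/-- The collected mass contributes b(j)zˢ where the shifted series misses b(j)zʲ; the differences
add up to `boundaryPoly`. -/
theorem pgf_map_sub_mul_pow (b : PMF ℕ) (s : ℕ) {z : ℂ} (hz : ‖z‖ ≤ 1) :
    pgf (b.map fun i => i - s) z * z ^ s = pgf b z + boundaryPoly b s z := by
  have hb := (summable_norm_pgf_term_of_norm_le_one b hz).of_norm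
  set c : ℂ := ((∑ i ∈ Finset.range s, (b i).toReal : ℝ) : ℂ)
  have h1 : ∀ j, (((b.map fun i => i - s) j).toReal : ℂ) * z ^ j * z ^ s =
      ((b (j + s)).toReal : ℂ) * z ^ (j + s) + if j = 0 then c * z ^ s else 0 := by
    intro j
    rw [toReal_map_sub]
    split_ifs with h
    · subst h
      push_cast [c, pow_add]
      ring
    · push_cast [pow_add]
      ring
  rw [pgf, ← tsum_mul_right, tsum_congr h1,
    Summable.tsum_add ((summable_nat_add_iff s).2 hb) (summable_of_ne_finset_zero (s := {0})
      fun j hj => if_neg (by simpa using hj)), tsum_ite_eq, pgf, ← hb.sum_add_tsum_nat_add s,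
    boundaryPoly]
  simp only [mul_sub, Finset.sum_sub_distrib, ← Finset.sum_mul, c]
  push_cast
  ring

theorem IsStationaryLaw.functional_equation {p q : PMF ℕ} {n s : ℕ}
    (hq : IsStationaryLaw p n s q) :
    ∃ b : PMF ℕ, ∀ z : ℂ, ‖z‖ ≤ 1 →
      pgf q z * (z ^ s - pgf p z ^ n) = boundaryPoly b s z := by
  -- The witness is the law of Q + A before truncation; stationarity says that truncating it returns
  -- `q`.
  refine ⟨q.bind fun x => (demandLaw p n).map fun a => x + a, fun z hz => ?_⟩
  set b := q.bind fun x => (demandLaw p n).map fun a => x + a with hb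
  have h1 : b.map (fun i => i - s) = q := by
    conv_rhs => rw [← hq]
    rw [hb, PMF.map_bind]
    simp only [PMF.map_comp]
    rfl
  have h2 := pgf_map_sub_mul_pow b s hz
  obtain ⟨h3, h4⟩ := pgf_demandLaw_aux p n (summable_norm_pgf_term_of_norm_le_one p hz)
  rw [h1, hb, (pgf_bind_add q _ (summable_norm_pgf_term_of_norm_le_one q hz) h3).2, h4, ← hb] at h2
  rw [mul_sub, h2]
  ring

theorem differentiable_boundaryPoly (b : PMF ℕ) (s : ℕ) : Differentiable ℂ (boundaryPoly b s) := by
  unfold boundaryPoly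
  fun_prop

theorem boundaryPoly_one (b : PMF ℕ) (s : ℕ) : boundaryPoly b s 1 = 0 := by
  simp [boundaryPoly]

/-- Only powers up to s occur, so division by zˢ leaves a bounded function outside the disk. This is
the bound needed for Liouville's theorem. -/
theorem norm_boundaryPoly_le (b : PMF ℕ) (s : ℕ) {z : ℂ} (hz : 1 ≤ ‖z‖) :
    ‖boundaryPoly b s z * (z ^ s)⁻¹‖ ≤ 2 * s := by
  have h : ∀ j ∈ Finset.range s, ‖((b j).toReal : ℂ) * (z ^ s - z ^ j)‖ ≤ 2 * ‖z‖ ^ s := by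
    intro j hj
    rw [norm_mul, Complex.norm_real, Real.norm_of_nonneg ENNReal.toReal_nonneg]
    have h1 : (b j).toReal ≤ 1 := by
      simpa using ENNReal.toReal_mono ENNReal.one_ne_top (b.coe_le_one j)
    have h2 : ‖z ^ s - z ^ j‖ ≤ 2 * ‖z‖ ^ s := by
      refine (norm_sub_le _ _).trans ?_
      rw [norm_pow, norm_pow]
      linarith [pow_le_pow_right₀ hz (Finset.mem_range.1 hj).le]
    nlinarith [norm_nonneg (z ^ s - z ^ j), ENNReal.toReal_nonneg (a := b j)]
  have hpos : 0 < ‖z‖ ^ s := by positivity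
  rw [norm_mul, norm_inv, norm_pow, ← div_eq_mul_inv, div_le_iff₀ hpos]
  refine (norm_sum_le_of_le _ h).trans_eq ?_
  simp
  ring

/-- Continuity up to the circle is what transfers the normalization Q(1) = 1 to the holomorphic
extension. -/
theorem continuousOn_pgf_closedBall (q : PMF ℕ) :
    ContinuousOn (pgf q) (Metric.closedBall 0 1) := by
  refine continuousOn_tsum (fun j => by fun_prop) (summable_toReal q) fun j z hz => ?_
  have hz' : ‖z‖ ≤ 1 := by simpa using hz
  rw [norm_mul, norm_pow, Complex.norm_real, Real.norm_of_nonneg ENNReal.toReal_nonneg]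
  exact mul_le_of_le_one_right ENNReal.toReal_nonneg (pow_le_one₀ (norm_nonneg z) hz')

theorem differentiableOn_pgf_ball (q : PMF ℕ) :
    DifferentiableOn ℂ (pgf q) (Metric.ball 0 1) := by
  refine differentiableOn_tsum_mul_pow fun x hx hx1 => ?_
  simpa [abs_of_nonneg hx] using
    summable_norm_pgf_term_of_norm_le_one q (z := (x : ℂ)) (by simpa [abs_of_nonneg hx] using hx1.le)

/-! ### Wiener–Hopf factorization in an annulus -/

/-- The Cauchy transform `(2πi)⁻¹ ∮_{|w| = ρ} f(w) / (z - w) dw`. -/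
noncomputable def cauchyTransform (f : ℂ → ℂ) (ρ : ℝ) (z : ℂ) : ℂ :=
  (2 * (Real.pi : ℂ) * Complex.I)⁻¹ * ∮ w in C(0, ρ), f w / (z - w)

theorem differentiableAt_cauchyTransform {f : ℂ → ℂ} {ρ : ℝ} (hρ : 0 < ρ)
    (hf : ContinuousOn f (Metric.sphere 0 ρ)) {z : ℂ} (hz : ‖z‖ ≠ ρ) :
    DifferentiableAt ℂ (cauchyTransform f ρ) z := by
  unfold cauchyTransform
  refine DifferentiableAt.const_mul ?_ _
  -- Half the distance from z to the circle: on the ball of radius `d` the kernel stays bounded,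
  -- which dominates its derivative.
  set d : ℝ := |‖z‖ - ρ| / 2 with hd
  have hd0 : 0 < d := by
    have := abs_pos.2 (sub_ne_zero.2 hz)
    positivity
  have hdist : ∀ x ∈ Metric.ball z d, ∀ θ : ℝ, d ≤ ‖x - circleMap 0 ρ θ‖ := by
    intro x hx θ
    have h1 : ‖x - z‖ < d := by simpa [dist_eq_norm] using hx
    have h2 := abs_norm_sub_norm_le z (circleMap 0 ρ θ)
    rw [norm_circleMap_zero, abs_of_pos hρ] at h2
    have h3 : ‖z - circleMap 0 ρ θ‖ ≤ ‖x - z‖ + ‖x - circleMap 0 ρ θ‖ := by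
      rw [norm_sub_rev x z]
      exact norm_sub_le_norm_sub_add_norm_sub _ _ _
    linarith
  have hne : ∀ x ∈ Metric.ball z d, ∀ θ : ℝ, x - circleMap 0 ρ θ ≠ 0 := fun x hx θ =>
    norm_pos_iff.1 (hd0.trans_le (hdist x hx θ))
  have hg : Continuous fun θ : ℝ => f (circleMap 0 ρ θ) :=
    hf.comp_continuous (continuous_circleMap 0 ρ) fun θ => by simp [abs_of_pos hρ]
  have hc := continuous_circleMap 0 ρ
  have hzball := Metric.mem_ball_self (x := z) hd0
  have hF : ∀ x ∈ Metric.ball z d, Continuous fun θ : ℝ =>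
      circleMap 0 ρ θ * Complex.I * (f (circleMap 0 ρ θ) / (x - circleMap 0 ρ θ)) := fun x hx =>
    (hc.mul continuous_const).mul (hg.div (continuous_const.sub hc) (hne x hx))
  have hF' : Continuous fun θ : ℝ => circleMap 0 ρ θ * Complex.I *
      (-f (circleMap 0 ρ θ) / (z - circleMap 0 ρ θ) ^ 2) :=
    (hc.mul continuous_const).mul (hg.neg.div ((continuous_const.sub hc).pow 2)
      fun θ => pow_ne_zero 2 (hne z hzball θ))
  have key := intervalIntegral.hasDerivAt_integral_of_dominated_loc_of_deriv_le (𝕜 := ℂ)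
    (μ := MeasureTheory.volume) (a := 0) (b := 2 * Real.pi) (x₀ := z)
    (F := fun x θ => circleMap 0 ρ θ * Complex.I *
      (f (circleMap 0 ρ θ) / (x - circleMap 0 ρ θ)))
    (F' := fun x θ => circleMap 0 ρ θ * Complex.I *
      (-f (circleMap 0 ρ θ) / (x - circleMap 0 ρ θ) ^ 2))
    (bound := fun θ => ρ * (‖f (circleMap 0 ρ θ)‖ / d ^ 2))
    (Metric.ball_mem_nhds z hd0)
    (by
      filter_upwards [Metric.ball_mem_nhds z hd0] with x hx
      exact (hF x hx).aestronglyMeasurable)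
    ((hF z hzball).intervalIntegrable _ _)
    hF'.aestronglyMeasurable
    (by
      refine Filter.Eventually.of_forall fun θ _ x hx => ?_
      rw [norm_mul, norm_mul, Complex.norm_I, mul_one, norm_circleMap_zero, abs_of_pos hρ,
        norm_div, norm_neg, norm_pow]
      have := hdist x hx θ
      gcongr)
    ((continuous_const.mul (hg.norm.div_const _)).intervalIntegrable _ _)
    (by
      refine Filter.Eventually.of_forall fun θ _ x hx => ?_
      have h := (((hasDerivAt_id x).sub_const (circleMap 0 ρ θ)).inv
        (hne x hx θ)).const_mul (f (circleMap 0 ρ θ))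
      refine HasDerivAt.const_mul _ ?_
      exact h.congr_deriv (by simp only [id]; ring))
  simpa [circleIntegral] using key.2.differentiableAt

/-- Here |z - w| ≥ ρ on the circle, and the factor 1/ρ cancels the normalized length of the circle.
-/
theorem norm_cauchyTransform_le {f : ℂ → ℂ} {ρ M : ℝ} (hρ : 0 < ρ)
    (hf : ∀ w ∈ Metric.sphere (0 : ℂ) ρ, ‖f w‖ ≤ M) {z : ℂ} (hz : 2 * ρ ≤ ‖z‖) :
    ‖cauchyTransform f ρ z‖ ≤ M := by
  have := circleIntegral.norm_two_pi_i_inv_smul_integral_le_of_norm_le_const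
    (f := fun w => f w / (z - w)) (c := 0) (C := M / ρ) hρ.le (fun w hw => ?_)
  · rwa [mul_div_cancel₀ _ hρ.ne', smul_eq_mul] at this
  · have hw' : ‖w‖ = ρ := by simpa using hw
    have h1 := norm_sub_norm_le z w
    have h2 := hf w hw
    have h3 := (norm_nonneg _).trans h2
    rw [norm_div]
    exact div_le_div₀ h3 h2 hρ (by linarith)

theorem cauchyTransform_eq_of_lt {f : ℂ → ℂ} {r₀ R ρ ρ' : ℝ} (hr₀ : 0 < r₀)
    (hf : ∀ z : ℂ, r₀ < ‖z‖ → ‖z‖ < R → DifferentiableAt ℂ f z)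
    (hρ : r₀ < ρ) (hρρ' : ρ ≤ ρ') (hρ' : ρ' < R) {z : ℂ} (hz : ‖z‖ < ρ) :
    cauchyTransform f ρ' z = cauchyTransform f ρ z := by
  unfold cauchyTransform
  congr 1
  have hd : ∀ w ∈ Metric.closedBall (0 : ℂ) ρ' \ Metric.ball 0 ρ,
      DifferentiableAt ℂ (fun w => f w / (z - w)) w := by
    intro w hw
    have h1 : ‖w‖ ≤ ρ' := by simpa using hw.1
    have h2 : ρ ≤ ‖w‖ := by simpa using hw.2
    refine (hf w (hρ.trans_le h2) (h1.trans_lt hρ')).div (by fun_prop) (sub_ne_zero.2 ?_)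
    rintro rfl
    linarith
  refine Complex.circleIntegral_eq_of_differentiable_on_annulus_off_countable (hr₀.trans hρ) hρρ'
    Set.countable_empty (fun w hw => (hd w hw).continuousAt.continuousWithinAt) fun w hw => ?_
  refine hd w ⟨Metric.ball_subset_closedBall hw.1.1, fun h => hw.1.2 ?_⟩
  exact Metric.ball_subset_closedBall h

/-- Cauchy's formula in an annulus: the divided difference of f at z is holomorphic there, so its
integrals over the two circles agree. The kernel 1/(z - w) integrates to -2πi over the outer circle
and to 0 over the inner one, which explains the order of the difference. -/
theorem cauchyTransform_sub_eq {f : ℂ → ℂ} {r₀ R ρ ρ' : ℝ} (hr₀ : 0 < r₀)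
    (hf : ∀ z : ℂ, r₀ < ‖z‖ → ‖z‖ < R → DifferentiableAt ℂ f z)
    (hρ : r₀ < ρ) (hρ' : ρ' < R) {z : ℂ} (hz : ρ < ‖z‖) (hz' : ‖z‖ < ρ') :
    cauchyTransform f ρ z - cauchyTransform f ρ' z = f z := by
  have hρ0 := hr₀.trans hρ
  have hA : IsOpen {w : ℂ | r₀ < ‖w‖ ∧ ‖w‖ < R} :=
    (isOpen_lt continuous_const continuous_norm).inter (isOpen_lt continuous_norm continuous_const)
  have hfA : DifferentiableOn ℂ f {w : ℂ | r₀ < ‖w‖ ∧ ‖w‖ < R} := fun w hw =>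
    (hf w hw.1 hw.2).differentiableWithinAt
  have hzA : {w : ℂ | r₀ < ‖w‖ ∧ ‖w‖ < R} ∈ 𝓝 z := hA.mem_nhds ⟨hρ.trans hz, hz'.trans hρ'⟩
  have hg : DifferentiableOn ℂ (dslope f z) {w : ℂ | r₀ < ‖w‖ ∧ ‖w‖ < R} :=
    (Complex.differentiableOn_dslope hzA).2 hfA
  have hd : ∀ w ∈ Metric.closedBall (0 : ℂ) ρ' \ Metric.ball 0 ρ,
      DifferentiableAt ℂ (dslope f z) w := by
    intro w hw
    have h1 : ‖w‖ ≤ ρ' := by simpa using hw.1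
    have h2 : ρ ≤ ‖w‖ := by simpa using hw.2
    exact hg.differentiableAt (hA.mem_nhds ⟨hρ.trans_le h2, h1.trans_lt hρ'⟩)
  have heq : (∮ w in C(0, ρ'), dslope f z w) = ∮ w in C(0, ρ), dslope f z w := by
    refine Complex.circleIntegral_eq_of_differentiable_on_annulus_off_countable hρ0
      (hz.trans hz').le
      Set.countable_empty (fun w hw => (hd w hw).continuousAt.continuousWithinAt) fun w hw => ?_
    refine hd w ⟨Metric.ball_subset_closedBall hw.1.1, fun h => hw.1.2 ?_⟩
    exact Metric.ball_subset_closedBall h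
  have hsplit : ∀ t : ℝ, ρ ≤ t → t ≤ ρ' → ‖z‖ ≠ t → (∮ w in C(0, t), dslope f z w) =
      f z * (∮ w in C(0, t), (z - w)⁻¹) - ∮ w in C(0, t), f w / (z - w) := by
    intro t ht ht' hzt
    have ht0 := hρ0.trans_le ht
    have hnw : ∀ w ∈ Metric.sphere (0 : ℂ) t, z - w ≠ 0 := by
      intro w hw h
      have : ‖w‖ = t := by simpa using hw
      rw [sub_eq_zero] at h
      exact hzt (h ▸ this)
    have hci : ContinuousOn (fun w => (z - w)⁻¹) (Metric.sphere (0 : ℂ) t) :=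
      ContinuousOn.inv₀ (by fun_prop) hnw
    have hcf : ContinuousOn f (Metric.sphere (0 : ℂ) t) := fun w hw => by
      have : ‖w‖ = t := by simpa using hw
      exact (hf w (by linarith) (by linarith)).continuousAt.continuousWithinAt
    have hi₁ : CircleIntegrable (fun w => f z * (z - w)⁻¹) 0 t :=
      (continuousOn_const.mul hci).circleIntegrable ht0.le
    have hi₂ : CircleIntegrable (fun w => f w / (z - w)) 0 t :=
      (hcf.div (by fun_prop) hnw).circleIntegrable ht0.le
    rw [← circleIntegral.integral_const_mul, ← circleIntegral.integral_sub hi₁ hi₂]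
    refine circleIntegral.integral_congr ht0.le fun w hw => ?_
    have h1 := hnw w hw
    have h2 : w ≠ z := fun h => h1 (by rw [h, sub_self])
    rw [dslope_of_ne _ h2, slope_def_field]
    have h3 : w - z ≠ 0 := sub_ne_zero.2 h2
    field_simp
    ring
  have hin : (∮ w in C(0, ρ'), (z - w)⁻¹) = -(2 * Real.pi * Complex.I) := by
    rw [← circleIntegral.integral_sub_inv_of_mem_ball (c := 0) (R := ρ') (by simpa using hz'),
      ← neg_one_mul, ← circleIntegral.integral_const_mul]
    congr 1
    funext w
    rw [neg_one_mul, ← inv_neg, neg_sub]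
  have hout : (∮ w in C(0, ρ), (z - w)⁻¹) = 0 := by
    refine Complex.circleIntegral_eq_zero_of_differentiable_on_off_countable hρ0.le
      Set.countable_empty (fun w hw => ?_) fun w hw => ?_
    · have : ‖w‖ ≤ ρ := by simpa using hw
      refine ContinuousAt.continuousWithinAt (ContinuousAt.inv₀ (by fun_prop) (sub_ne_zero.2 ?_))
      rintro rfl
      linarith
    · have : ‖w‖ < ρ := by simpa using hw.1
      refine DifferentiableAt.inv (by fun_prop) (sub_ne_zero.2 ?_)
      rintro rfl
      linarith
  rw [hsplit ρ le_rfl (hz.trans hz').le hz.ne', hsplit ρ' (hz.trans hz').le le_rfl hz'.ne, hin,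
    hout] at heq
  unfold cauchyTransform
  have hpi : (2 * Real.pi * Complex.I : ℂ) ≠ 0 := Complex.two_pi_I_ne_zero
  rw [← mul_sub, inv_mul_eq_iff_eq_mul₀ hpi]
  linear_combination heq

/-- If `g = q · exp f` on the annulus `r₀ < |z| < R`, where `q` is holomorphic on `|z| < R` and `g`
is holomorphic and bounded on `|z| > r₀`, then `g` and `q` are multiples of the exponentials of the
outer and inner parts of `f`, by the same constant. -/
theorem wienerHopf_eq {f g q : ℂ → ℂ} {r₀ R ρ M : ℝ} (hr₀ : 0 < r₀)
    (hf : ∀ z : ℂ, r₀ < ‖z‖ → ‖z‖ < R → DifferentiableAt ℂ f z)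
    (hg : ∀ z : ℂ, r₀ < ‖z‖ → DifferentiableAt ℂ g z)
    (hgM : ∀ z : ℂ, r₀ < ‖z‖ → ‖g z‖ ≤ M)
    (hq : ∀ z : ℂ, ‖z‖ < R → DifferentiableAt ℂ q z)
    (hgq : ∀ z : ℂ, r₀ < ‖z‖ → ‖z‖ < R → g z = q z * Complex.exp (f z))
    (hρ : r₀ < ρ) (hρR : ρ < R) {z ζ : ℂ} (hz : ρ < ‖z‖) (hζ : ‖ζ‖ < ρ) :
    g z * Complex.exp (-cauchyTransform f ρ z) = q ζ * Complex.exp (-cauchyTransform f ρ ζ) := by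
  obtain ⟨ρ', h1, h2⟩ := exists_between hρR
  have hρ0 := hr₀.trans hρ
  have hfc : ∀ t, r₀ < t → t < R → ContinuousOn f (Metric.sphere 0 t) := fun t ht ht' w hw => by
    have : ‖w‖ = t := by simpa using hw
    exact (hf w (by linarith) (by linarith)).continuousAt.continuousWithinAt
  -- As f is the difference of the transforms over ρ and ρ', the functions `G₁` and `G₂` agree on ρ
  -- < |w| < ρ' and glue to an entire function.
  set G₁ : ℂ → ℂ := fun w => q w * Complex.exp (-cauchyTransform f ρ' w) with hG₁
  set G₂ : ℂ → ℂ := fun w => g w * Complex.exp (-cauchyTransform f ρ w) with hG₂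
  set G : ℂ → ℂ := fun w => if ‖w‖ < ρ' then G₁ w else G₂ w with hG
  have hGin : ∀ w : ℂ, ‖w‖ < ρ' → G w = G₁ w := fun w hw => if_pos hw
  have hGout : ∀ w : ℂ, ρ < ‖w‖ → G w = G₂ w := by
    intro w hw
    by_cases h : ‖w‖ < ρ'
    · rw [hGin w h, hG₁, hG₂]
      simp only
      rw [hgq w (hρ.trans hw) (h.trans h2), mul_assoc, ← Complex.exp_add,
        ← cauchyTransform_sub_eq hr₀ hf hρ h2 hw h]
      ring_nf
    · exact if_neg h
  have hd : Differentiable ℂ G := by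
    intro w
    by_cases h : ‖w‖ < ρ'
    · have : G =ᶠ[𝓝 w] G₁ := by
        filter_upwards [(isOpen_lt continuous_norm continuous_const).mem_nhds h] with v hv
        exact hGin v hv
      refine DifferentiableAt.congr_of_eventuallyEq ?_ this
      exact (hq w (h.trans h2)).mul (differentiableAt_cauchyTransform (hρ0.trans h1)
        (hfc ρ' (hρ.trans h1) h2) h.ne).neg.cexp
    · have hw : ρ < ‖w‖ := by linarith
      have : G =ᶠ[𝓝 w] G₂ := by
        filter_upwards [(isOpen_lt continuous_const continuous_norm).mem_nhds hw] with v hv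
        exact hGout v hv
      refine DifferentiableAt.congr_of_eventuallyEq ?_ this
      exact (hg w (hρ.trans hw)).mul (differentiableAt_cauchyTransform hρ0
        (hfc ρ hρ hρR) hw.ne').neg.cexp
  have hb : Bornology.IsBounded (Set.range G) := by
    obtain ⟨B, hB⟩ := (isCompact_closedBall (0 : ℂ) (2 * ρ)).exists_bound_of_continuousOn
      hd.continuous.continuousOn
    obtain ⟨F, hF⟩ := (isCompact_sphere (0 : ℂ) ρ).exists_bound_of_continuousOn (hfc ρ hρ hρR)
    rw [isBounded_iff_forall_norm_le]
    refine ⟨max B (M * Real.exp F), ?_⟩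
    rintro _ ⟨w, rfl⟩
    by_cases h : ‖w‖ ≤ 2 * ρ
    · exact (hB w (by simpa using h)).trans (le_max_left _ _)
    · push Not at h
      refine le_trans ?_ (le_max_right _ _)
      rw [hGout w (by linarith), hG₂]
      simp only
      rw [norm_mul, Complex.norm_exp]
      have h3 := hgM w (by linarith)
      refine mul_le_mul h3 (Real.exp_le_exp.2 ?_) (Real.exp_pos _).le ((norm_nonneg _).trans h3)
      refine (Complex.re_le_norm _).trans ?_
      rw [norm_neg]
      exact norm_cauchyTransform_le hρ0 hF h.le
  have := hd.apply_eq_apply_of_bounded hb z ζ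
  rw [hGout z hz, hGin ζ (hζ.trans h1)] at this
  rw [← cauchyTransform_eq_of_lt hr₀ hf hρ h1.le h2 hζ]
  exact this

/-! ### The residue of the generating function at an outer zero -/

theorem analyticAt_dslope {f : ℂ → ℂ} {a z : ℂ} (ha : AnalyticAt ℂ f a) (hz : AnalyticAt ℂ f z) :
    AnalyticAt ℂ (dslope f a) z := by
  rw [Complex.analyticAt_iff_eventually_differentiableAt] at ha hz ⊢
  have h : ∀ w, (∀ᶠ v in 𝓝 w, DifferentiableAt ℂ f v) → DifferentiableAt ℂ (dslope f a) w := by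
    intro w hw
    by_cases hwa : w = a
    · subst hwa
      have hs : {v | DifferentiableAt ℂ f v} ∈ 𝓝 w := hw
      exact ((Complex.differentiableOn_dslope hs).2
        fun v hv => DifferentiableAt.differentiableWithinAt hv).differentiableAt hs
    · exact (differentiableAt_dslope_of_ne hwa).2 hw.self_of_nhds
  filter_upwards [hz.eventually_nhds] with w hw using h w hw

theorem dslope_mul_sub (f : ℂ → ℂ) {a : ℂ} (ha : f a = 0) (z : ℂ) :
    dslope f a z * (z - a) = f z := by
  have := sub_smul_dslope f a z
  rw [smul_eq_mul, ha, sub_zero] at this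
  rw [mul_comm, this]

/-- Near w, F(z) = φ(z)/(z - w) with φ holomorphic, so by Cauchy's formula the circle integrals are
constant for small radii. Equality off w suffices, whatever value F has at the pole. -/
theorem residueAt_eq_div_deriv {F N D : ℂ → ℂ} {w : ℂ} (hN : AnalyticAt ℂ N w)
    (hD : AnalyticAt ℂ D w) (hD0 : D w = 0) (hD' : deriv D w ≠ 0)
    (h : ∀ᶠ z in 𝓝[≠] w, F z * D z = N z) :
    residueAt F w = N w / deriv D w := by
  set φ : ℂ → ℂ := fun z => N z / dslope D w z with hφ
  have hds := analyticAt_dslope hD hD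
  have hds0 : dslope D w w ≠ 0 := by rwa [dslope_same]
  have hφa : AnalyticAt ℂ φ w := hN.div hds hds0
  have h1 : ∀ᶠ z in 𝓝 w, DifferentiableAt ℂ φ z ∧ (z ≠ w → F z = (z - w)⁻¹ • φ z) := by
    filter_upwards [Complex.analyticAt_iff_eventually_differentiableAt.1 hφa,
      eventually_nhdsWithin_iff.1 h, hds.continuousAt.eventually_ne hds0] with z hz1 hz2 hz3
    refine ⟨hz1, fun hzw => ?_⟩
    have h2 := hz2 hzw
    have h3 : z - w ≠ 0 := sub_ne_zero.2 hzw
    rw [← dslope_mul_sub D hD0 z] at h2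
    simp only [hφ, smul_eq_mul]
    rw [← h2]
    field_simp
  obtain ⟨δ, hδ, hball⟩ := Metric.eventually_nhds_iff_ball.1 h1
  refine Filter.Tendsto.limUnder_eq (tendsto_const_nhds.congr' ?_)
  filter_upwards [Ioo_mem_nhdsGT hδ] with ρ hρ
  have hsub : Metric.closedBall w ρ ⊆ Metric.ball w δ := Metric.closedBall_subset_ball hρ.2
  have h2 : (∮ z in C(w, ρ), F z) = ∮ z in C(w, ρ), (z - w)⁻¹ • φ z := by
    refine circleIntegral.integral_congr hρ.1.le fun z hz => ?_
    refine (hball z (hsub (Metric.sphere_subset_closedBall hz))).2 ?_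
    exact Metric.ne_of_mem_sphere hz hρ.1.ne'
  have h3 : DifferentiableOn ℂ φ (Metric.closedBall w ρ) := fun z hz =>
    (hball z (hsub hz)).1.differentiableWithinAt
  rw [h2, h3.circleIntegral_sub_inv_smul (Metric.mem_ball_self hρ.1), smul_eq_mul, ← mul_assoc,
    inv_mul_cancel₀ Complex.two_pi_I_ne_zero, one_mul, hφ]
  simp only [dslope_same]

/-! ### The function zˢ - X(z)ⁿ and the exact residue formula -/

section

variable {p : PMF ℕ} {n s : ℕ}

/-- The function `zˢ - X(z)ⁿ`. -/
noncomputable def charFun (p : PMF ℕ) (n s : ℕ) (z : ℂ) : ℂ := z ^ s - pgf p z ^ n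

theorem analyticAt_charFun {z : ℂ} (hz : ENNReal.ofReal ‖z‖ < pgfRadius p) :
    AnalyticAt ℂ (charFun p n s) z :=
  (analyticAt_id.pow s).sub ((analyticAt_pgf hz).pow n)

theorem hasDerivAt_charFun {z : ℂ} (hz : ENNReal.ofReal ‖z‖ < pgfRadius p) :
    HasDerivAt (charFun p n s)
      (s * z ^ (s - 1) - n * pgf p z ^ (n - 1) * deriv (pgf p) z) z :=
  (hasDerivAt_pow s z).sub ((differentiableAt_pgf hz).hasDerivAt.pow n)

theorem charFun_one : charFun p n s 1 = 0 := by
  simp [charFun, pgf_one]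

theorem deriv_charFun_one (hr : 1 < pgfRadius p) :
    deriv (charFun p n s) 1 = ((s - n * lawMean p : ℝ) : ℂ) := by
  rw [(hasDerivAt_charFun (one_lt_radius_ofReal hr (by simp))).deriv, pgf_one, deriv_pgf_one hr]
  simp

theorem isOuterZero_iff {w : ℂ} : IsOuterZero p n s w ↔
    1 < ‖w‖ ∧ ENNReal.ofReal ‖w‖ < pgfRadius p ∧ charFun p n s w = 0 := by
  unfold IsOuterZero charFun
  constructor
  · rintro ⟨h1, h2, h3⟩
    exact ⟨h1, h2, by rwa [← pgf_demandLaw n h2]⟩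
  · rintro ⟨h1, h2, h3⟩
    exact ⟨h1, h2, by rwa [pgf_demandLaw n h2]⟩

theorem charFun_ofReal (p : PMF ℕ) (n s : ℕ) (x : ℝ) :
    charFun p n s x = ((x ^ s - (pgf p (x : ℂ)).re ^ n : ℝ) : ℂ) := by
  have h : pgf p (x : ℂ) = ((pgf p (x : ℂ)).re : ℂ) := by
    rw [pgf_ofReal, Complex.ofReal_re]
  rw [charFun, h]
  push_cast
  simp

/-- The slope of xˢ - X(x)ⁿ at its zero 1 is s - nμ > 0, so the difference is positive just to the
right of 1; a sign change before Z₀ would create a zero. -/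
theorem re_pgf_pow_lt (hr : 1 < pgfRadius p) (hdrift : n * lawMean p < s) {Z₀ : ℝ}
    (hZ₀ : ENNReal.ofReal Z₀ < pgfRadius p)
    (hne : ∀ z : ℂ, 1 < ‖z‖ → ‖z‖ < Z₀ → charFun p n s z ≠ 0) {x : ℝ} (hx : 1 < x) (hxZ : x < Z₀) :
    (pgf p (x : ℂ)).re ^ n < x ^ s := by
  set d : ℝ → ℝ := fun x => (charFun p n s (x : ℂ)).re with hd
  have hdx : ∀ x : ℝ, d x = x ^ s - (pgf p (x : ℂ)).re ^ n := fun x => by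
    rw [hd]
    simp only
    rw [charFun_ofReal, Complex.ofReal_re]
  have hderiv : HasDerivAt d (s - n * lawMean p) 1 := by
    have h := (analyticAt_charFun (n := n) (s := s)
      (one_lt_radius_ofReal hr (z := ((1 : ℝ) : ℂ)) (by simp))).differentiableAt.hasDerivAt
    have h2 := h.real_of_complex
    rw [Complex.ofReal_one, deriv_charFun_one hr, Complex.ofReal_re] at h2
    exact h2
  have hd1 : d 1 = 0 := by simp [hd, charFun_one]
  have hrad : ∀ y : ℝ, 1 ≤ y → y ≤ x → ENNReal.ofReal ‖(y : ℂ)‖ < pgfRadius p := by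
    intro y hy hyx
    refine (ENNReal.ofReal_le_ofReal ?_).trans_lt hZ₀
    rw [Complex.norm_real, Real.norm_of_nonneg (by linarith)]
    linarith
  obtain ⟨y, hy1, hyx, hdy⟩ : ∃ y, 1 < y ∧ y < x ∧ 0 < d y := by
    have h := (hasDerivAt_iff_tendsto_slope.1 hderiv).mono_left (nhdsGT_le_nhdsNE 1)
    have h2 := h.eventually_const_lt (sub_pos.2 hdrift)
    obtain ⟨y, hy, hy'⟩ := (h2.and (Ioo_mem_nhdsGT hx)).exists
    refine ⟨y, hy'.1, hy'.2, ?_⟩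
    rw [slope_def_field, hd1, sub_zero] at hy
    exact (div_pos_iff_of_pos_right (sub_pos.2 hy'.1)).1 hy
  by_contra! hcon
  have hdx0 : d x ≤ 0 := by rw [hdx]; linarith
  have hcont : ContinuousOn d (Set.Icc y x) := by
    intro t ht
    have h := (analyticAt_charFun (n := n) (s := s) (hrad t (by linarith [ht.1]) ht.2)).continuousAt
    exact (Complex.continuous_re.continuousAt.comp
      (h.comp Complex.continuous_ofReal.continuousAt)).continuousWithinAt
  obtain ⟨t, ht, ht0⟩ := intermediate_value_Icc' hyx.le hcont ⟨hdx0, hdy.le⟩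
  have ht1 : 1 < t := by linarith [ht.1]
  have hnt : ‖(t : ℂ)‖ = t := by rw [Complex.norm_real, Real.norm_of_nonneg (by linarith)]
  refine hne t (by rwa [hnt]) (by rw [hnt]; linarith [ht.2]) ?_
  rw [charFun_ofReal, ← hdx, ht0, Complex.ofReal_zero]

/-- Since |X(z)| ≤ X(|z|), the real case suffices. The bound keeps 1 - z⁻ˢA(z) in the right half
plane, where the principal logarithm is holomorphic. -/
theorem norm_inv_pow_mul_pgf_lt_one (hr : 1 < pgfRadius p) (hdrift : n * lawMean p < s) {Z₀ : ℝ}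
    (hZ₀ : ENNReal.ofReal Z₀ < pgfRadius p)
    (hne : ∀ z : ℂ, 1 < ‖z‖ → ‖z‖ < Z₀ → charFun p n s z ≠ 0) {z : ℂ} (hz : 1 < ‖z‖)
    (hzZ : ‖z‖ < Z₀) : ‖(z ^ s)⁻¹ * pgf (demandLaw p n) z‖ < 1 := by
  have hzr : ENNReal.ofReal ‖z‖ < pgfRadius p := (ENNReal.ofReal_le_ofReal hzZ.le).trans_lt hZ₀
  have h1 := re_pgf_pow_lt hr hdrift hZ₀ hne hz hzZ
  have h2 : ‖pgf p z‖ ^ n ≤ (pgf p (‖z‖ : ℂ)).re ^ n :=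
    pow_le_pow_left₀ (norm_nonneg _) (norm_pgf_le hzr) n
  have h3 : 0 < ‖z‖ ^ s := by positivity
  rw [pgf_demandLaw n hzr, norm_mul, norm_inv, norm_pow, norm_pow, inv_mul_lt_iff₀ h3, mul_one]
  linarith

theorem charFun_ne_zero_of_norm_eq_one (hr : 1 < pgfRadius p)
    (hmax : ∀ r₁ : ℝ, 0 < r₁ → ENNReal.ofReal r₁ < pgfRadius p →
      ∀ z : ℂ, ‖z‖ = r₁ → z ≠ (r₁ : ℂ) → ‖pgf p z‖ < (pgf p (r₁ : ℂ)).re)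
    (hn : n ≠ 0) {z : ℂ} (hz : ‖z‖ = 1) (hz1 : z ≠ 1) : charFun p n s z ≠ 0 := by
  have h1 := hmax 1 one_pos (by simpa using hr) z hz (by simpa using hz1)
  rw [Complex.ofReal_one, pgf_one, Complex.one_re] at h1
  intro h
  have h2 : ‖z ^ s‖ = ‖pgf p z ^ n‖ := by rw [sub_eq_zero.1 h]
  rw [norm_pow, hz, one_pow, norm_pow] at h2
  linarith [pow_lt_one₀ (norm_nonneg _) h1 hn]

/-- The holomorphic extension of the generating function of the stationary law across the unit
circle. -/
theorem exists_holomorphic_extension (hr : 1 < pgfRadius p)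
    (hmax : ∀ r₁ : ℝ, 0 < r₁ → ENNReal.ofReal r₁ < pgfRadius p →
      ∀ z : ℂ, ‖z‖ = r₁ → z ≠ (r₁ : ℂ) → ‖pgf p z‖ < (pgf p (r₁ : ℂ)).re)
    (hn : n ≠ 0) (hdrift : n * lawMean p < s) {Z₀ : ℝ} (hZ₀1 : 1 < Z₀)
    (hZ₀ : ENNReal.ofReal Z₀ < pgfRadius p)
    (hne : ∀ z : ℂ, 1 < ‖z‖ → ‖z‖ < Z₀ → charFun p n s z ≠ 0) {q b : PMF ℕ}
    (hqb : ∀ z : ℂ, ‖z‖ ≤ 1 → pgf q z * charFun p n s z = boundaryPoly b s z) :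
    ∃ f : ℂ → ℂ, (∀ z : ℂ, ‖z‖ < Z₀ → DifferentiableAt ℂ f z) ∧ f 1 = 1 ∧
      ∀ z : ℂ, 1 < ‖z‖ → ‖z‖ < Z₀ → f z * charFun p n s z = boundaryPoly b s z := by
  set D := charFun p n s with hD
  set N := boundaryPoly b s with hN
  have hrad : ∀ z : ℂ, ‖z‖ < Z₀ → ENNReal.ofReal ‖z‖ < pgfRadius p := fun z hz =>
    (ENNReal.ofReal_le_ofReal hz.le).trans_lt hZ₀
  have hNa : ∀ z, AnalyticAt ℂ N z := fun z => (differentiable_boundaryPoly b s).analyticAt z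
  have hDa : ∀ z : ℂ, ‖z‖ < Z₀ → AnalyticAt ℂ D z := fun z hz => analyticAt_charFun (hrad z hz)
  have hone : ‖(1 : ℂ)‖ < Z₀ := by simpa using hZ₀1
  have hD1 : D 1 = 0 := charFun_one
  have hN1 : N 1 = 0 := boundaryPoly_one b s
  have hds : ∀ z : ℂ, 1 ≤ ‖z‖ → ‖z‖ < Z₀ → dslope D 1 z ≠ 0 := by
    intro z hz hzZ
    by_cases hz1 : z = 1
    · rw [hz1, dslope_same, hD, deriv_charFun_one hr]
      exact_mod_cast (sub_pos.2 hdrift).ne'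
    · intro h
      have h0 : D z = 0 := by rw [← dslope_mul_sub D hD1 z, h, zero_mul]
      rcases hz.eq_or_lt with h1 | h1
      · exact charFun_ne_zero_of_norm_eq_one hr hmax hn h1.symm hz1 h0
      · exact hne z h1 hzZ h0
  -- Dividing N and D by z - 1 removes their common zero at 1; the remaining denominator does not
  -- vanish on 1 ≤ |z| < Z₀.
  set h : ℂ → ℂ := fun z => dslope N 1 z / dslope D 1 z with hh
  set f : ℂ → ℂ := fun z => if ‖z‖ < 1 then pgf q z else h z with hf
  have hfin : ∀ z : ℂ, ‖z‖ < 1 → f z = pgf q z := fun z hz => if_pos hz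
  have hfd : ∀ z : ℂ, ‖z‖ < Z₀ → DifferentiableAt ℂ f z := by
    intro z hz
    rcases lt_or_ge ‖z‖ 1 with hz1 | hz1
    · have : f =ᶠ[𝓝 z] pgf q := by
        filter_upwards [(isOpen_lt continuous_norm continuous_const).mem_nhds hz1] with v hv
        exact hfin v hv
      exact ((differentiableOn_pgf_ball q).differentiableAt
        (Metric.isOpen_ball.mem_nhds (by simpa using hz1))).congr_of_eventuallyEq this
    · have ha : AnalyticAt ℂ h z := (analyticAt_dslope (hNa 1) (hNa z)).div
        (analyticAt_dslope (hDa 1 hone) (hDa z hz)) (hds z hz1 hz)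
      have : f =ᶠ[𝓝 z] h := by
        filter_upwards [(analyticAt_dslope (hDa 1 hone) (hDa z hz)).continuousAt.eventually_ne
          (hds z hz1 hz)] with v hv
        by_cases hv1 : ‖v‖ < 1
        · have h1 : v - 1 ≠ 0 := by
            rw [sub_ne_zero]
            rintro rfl
            simp at hv1
          have h2 := hqb v hv1.le
          rw [← dslope_mul_sub D hD1 v, ← dslope_mul_sub N hN1 v, ← mul_assoc] at h2
          rw [hfin v hv1, hh, eq_div_iff hv]
          exact mul_right_cancel₀ h1 h2
        · exact if_neg hv1
      exact ha.differentiableAt.congr_of_eventuallyEq this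
  refine ⟨f, hfd, ?_, fun z hz hzZ => ?_⟩
  · have hcl : (1 : ℂ) ∈ closure (Metric.ball (0 : ℂ) 1) := by
      rw [closure_ball _ one_ne_zero]
      simp
    have := mem_closure_iff_nhdsWithin_neBot.1 hcl
    have h1 : Filter.Tendsto f (𝓝[Metric.ball 0 1] 1) (𝓝 (f 1)) :=
      (hfd 1 hone).continuousAt.continuousWithinAt
    have h2 : Filter.Tendsto (pgf q) (𝓝[Metric.ball 0 1] 1) (𝓝 (pgf q 1)) :=
      (continuousOn_pgf_closedBall q 1 (by simp)).mono Metric.ball_subset_closedBall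
    have h3 : f =ᶠ[𝓝[Metric.ball 0 1] 1] pgf q := by
      filter_upwards [self_mem_nhdsWithin] with v hv
      exact hfin v (by simpa using hv)
    exact (tendsto_nhds_unique h1 (h2.congr' h3.symm)).trans (pgf_one q)
  · have h1 : f z = h z := if_neg (by linarith)
    rw [h1, hh, ← dslope_mul_sub D hD1 z, ← dslope_mul_sub N hN1 z]
    have := hds z hz.le hzZ
    field_simp

/-- The Wiener–Hopf constant is evaluated at the inner point 1, where the extension of Q equals 1.
-/
theorem boundaryPoly_eq_exp_contourI (hr : 1 < pgfRadius p)
    (hmax : ∀ r₁ : ℝ, 0 < r₁ → ENNReal.ofReal r₁ < pgfRadius p →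
      ∀ z : ℂ, ‖z‖ = r₁ → z ≠ (r₁ : ℂ) → ‖pgf p z‖ < (pgf p (r₁ : ℂ)).re)
    (hn : n ≠ 0) (hdrift : n * lawMean p < s) {Z₀ : ℝ}
    (hZ₀ : ENNReal.ofReal Z₀ < pgfRadius p)
    (hne : ∀ z : ℂ, 1 < ‖z‖ → ‖z‖ < Z₀ → charFun p n s z ≠ 0) {q b : PMF ℕ}
    (hqb : ∀ z : ℂ, ‖z‖ ≤ 1 → pgf q z * charFun p n s z = boundaryPoly b s z)
    {ε : ℝ} (hε : 0 < ε) (hεZ : 1 + ε < Z₀) {Z : ℂ} (hZ : 1 + ε < ‖Z‖) :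
    boundaryPoly b s Z = Z ^ s * Complex.exp (contourI p n s ε Z - contourI p n s ε 1) := by
  obtain ⟨F, hF, hF1, hFD⟩ := exists_holomorphic_extension hr hmax hn hdrift
    (by linarith : 1 < Z₀) hZ₀ hne hqb
  set f : ℂ → ℂ := fun z => Complex.log (1 - (z ^ s)⁻¹ * pgf (demandLaw p n) z) with hf
  have hrad : ∀ z : ℂ, ‖z‖ < Z₀ → ENNReal.ofReal ‖z‖ < pgfRadius p := fun z hz =>
    (ENNReal.ofReal_le_ofReal hz.le).trans_lt hZ₀
  have hz0 : ∀ z : ℂ, 1 < ‖z‖ → z ^ s ≠ 0 := fun z hz =>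
    pow_ne_zero s (norm_pos_iff.1 (by linarith))
  have hslit : ∀ z : ℂ, 1 < ‖z‖ → ‖z‖ < Z₀ →
      1 - (z ^ s)⁻¹ * pgf (demandLaw p n) z ∈ Complex.slitPlane := by
    intro z hz hzZ
    left
    have h1 := norm_inv_pow_mul_pgf_lt_one hr hdrift hZ₀ hne hz hzZ
    have h2 := (Complex.re_le_norm _).trans_lt h1
    rw [Complex.sub_re, Complex.one_re]
    linarith
  have hfd : ∀ z : ℂ, 1 < ‖z‖ → ‖z‖ < Z₀ → DifferentiableAt ℂ f z := by
    intro z hz hzZ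
    have hA : DifferentiableAt ℂ (pgf (demandLaw p n)) z := by
      refine ((differentiableAt_pgf (hrad z hzZ)).pow n).congr_of_eventuallyEq ?_
      filter_upwards [(isOpen_norm_lt_radius p).mem_nhds (hrad z hzZ)] with v hv
      exact pgf_demandLaw n hv
    exact (((((differentiableAt_id.pow s).inv (hz0 z hz)).mul hA).const_sub 1)).clog
      (hslit z hz hzZ)
  have key := wienerHopf_eq (f := f) (g := fun z => boundaryPoly b s z * (z ^ s)⁻¹) (q := F)
    (r₀ := 1) (R := Z₀) (ρ := 1 + ε) (M := 2 * s) one_pos hfd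
    (fun z hz => ((differentiable_boundaryPoly b s) z).mul
      ((differentiableAt_id.pow s).inv (hz0 z hz)))
    (fun z hz => norm_boundaryPoly_le b s hz.le) hF
    (fun z hz hzZ => by
      have h0 := hz0 z hz
      rw [hf]
      simp only
      rw [Complex.exp_log (Complex.slitPlane_ne_zero (hslit z hz hzZ)), ← hFD z hz hzZ, charFun,
        pgf_demandLaw n (hrad z hzZ)]
      field_simp)
    (by linarith) hεZ hZ (ζ := 1) (by simpa using hε)
  rw [hF1, one_mul] at key
  change boundaryPoly b s Z * (Z ^ s)⁻¹ * Complex.exp (-contourI p n s ε Z) =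
    Complex.exp (-contourI p n s ε 1) at key
  have h0 := hz0 Z (by linarith)
  rw [sub_eq_add_neg, Complex.exp_add, ← key, Complex.exp_neg]
  have := Complex.exp_ne_zero (contourI p n s ε Z)
  field_simp

/-- Identity theorem: Q D - N vanishes near 0, and infinite meromorphic order propagates through a
connected disk containing Z. Values at isolated points are not controlled, hence the punctured
neighbourhood. -/
theorem IsMeromorphicContinuation.eventually_mul_eq {q b : PMF ℕ} {Q : ℂ → ℂ}
    (hQ : IsMeromorphicContinuation q (pgfRadius p) Q)
    (hqb : ∀ z : ℂ, ‖z‖ ≤ 1 → pgf q z * charFun p n s z = boundaryPoly b s z) {Z : ℂ}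
    (hZ : ENNReal.ofReal ‖Z‖ < pgfRadius p) :
    ∀ᶠ z in 𝓝[≠] Z, Q z * charFun p n s z = boundaryPoly b s z := by
  obtain ⟨R, h1, hR0, h2⟩ := exists_real_between_radius hZ
  have hrad : ∀ z ∈ Metric.ball (0 : ℂ) R, ENNReal.ofReal ‖z‖ < pgfRadius p := fun z hz => by
    have hz' : ‖z‖ < R := by simpa using hz
    exact (ENNReal.ofReal_le_ofReal hz'.le).trans_lt h2
  set H : ℂ → ℂ := fun z => Q z * charFun p n s z - boundaryPoly b s z with hH
  have hm : MeromorphicOn H (Metric.ball 0 R) := fun z hz =>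
    ((hQ.meromorphic z (hrad z hz)).mul (analyticAt_charFun (hrad z hz)).meromorphicAt).sub
      ((differentiable_boundaryPoly b s).analyticAt z).meromorphicAt
  have h0 : meromorphicOrderAt H 0 = ⊤ := by
    rw [meromorphicOrderAt_eq_top_iff]
    refine eventually_nhdsWithin_of_eventually_nhds ?_
    filter_upwards [Metric.ball_mem_nhds (0 : ℂ) one_pos] with z hz
    have hz' : ‖z‖ < 1 := by simpa using hz
    rw [hH]
    simp only
    rw [hQ.eq_pgf z hz', hqb z hz'.le, sub_self]
  have hZtop : meromorphicOrderAt H Z = ⊤ := by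
    by_contra hcon
    exact hm.meromorphicOrderAt_ne_top_of_isPreconnected
      (convex_ball (0 : ℂ) R).isPreconnected (by simpa using h1) (by simpa using hR0) hcon h0
  filter_upwards [meromorphicOrderAt_eq_top_iff.1 hZtop] with z hz
  exact sub_eq_zero.1 hz

/-- The residue of the generating function of the stationary law at a simple outer zero. -/
theorem residueAt_outerZero (hr : 1 < pgfRadius p)
    (hmax : ∀ r₁ : ℝ, 0 < r₁ → ENNReal.ofReal r₁ < pgfRadius p →
      ∀ z : ℂ, ‖z‖ = r₁ → z ≠ (r₁ : ℂ) → ‖pgf p z‖ < (pgf p (r₁ : ℂ)).re)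
    (hn : n ≠ 0) (hdrift : n * lawMean p < s) {q : PMF ℕ} (hq : IsStationaryLaw p n s q)
    {Q : ℂ → ℂ} (hQ : IsMeromorphicContinuation q (pgfRadius p) Q) {Z₀ : ℝ}
    (hZ₀ : IsLeast {x : ℝ | ∃ w : ℂ, IsOuterZero p n s w ∧ ‖w‖ = x} Z₀)
    {ε : ℝ} (hε : 0 < ε) (hεZ : 1 + ε < Z₀) {Z : ℂ} (hZ : IsOuterZero p n s Z)
    (hsimple : s * Z ^ (s - 1) - n * pgf p Z ^ (n - 1) * deriv (pgf p) Z ≠ 0) :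
    residueAt Q Z = Z ^ s * Complex.exp (contourI p n s ε Z - contourI p n s ε 1) /
      (s * Z ^ (s - 1) - n * pgf p Z ^ (n - 1) * deriv (pgf p) Z) := by
  obtain ⟨b, hb⟩ := hq.functional_equation
  have hZ' := isOuterZero_iff.1 hZ
  have hZ₀r : ENNReal.ofReal Z₀ < pgfRadius p := by
    obtain ⟨w, hw, rfl⟩ := hZ₀.1
    exact hw.2.1
  have hne : ∀ z : ℂ, 1 < ‖z‖ → ‖z‖ < Z₀ → charFun p n s z ≠ 0 := by
    intro z hz hzZ h
    have : IsOuterZero p n s z := isOuterZero_iff.2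
      ⟨hz, (ENNReal.ofReal_le_ofReal hzZ.le).trans_lt hZ₀r, h⟩
    linarith [hZ₀.2 ⟨z, this, rfl⟩]
  have hZZ₀ : Z₀ ≤ ‖Z‖ := hZ₀.2 ⟨Z, hZ, rfl⟩
  have hd := (hasDerivAt_charFun (n := n) (s := s) hZ.2.1).deriv
  rw [residueAt_eq_div_deriv (N := boundaryPoly b s) (D := charFun p n s)
    ((differentiable_boundaryPoly b s).analyticAt Z) (analyticAt_charFun hZ.2.1) hZ'.2.2
    (by rwa [hd]) (hQ.eventually_mul_eq hb hZ.2.1), hd,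
    boundaryPoly_eq_exp_contourI hr hmax hn hdrift hZ₀r hne hb hε hεZ (hεZ.trans_le hZZ₀)]

end

/-! ### Local expansions at the point `1` and the roots of the limiting quadratic equation -/

/-- Two successive divided differences extract t², and the second is continuous, hence bounded near
0. -/
theorem AnalyticAt.exists_norm_le_mul_norm_sq {f : ℂ → ℂ} (hf : AnalyticAt ℂ f 0) (h0 : f 0 = 0)
    (h1 : deriv f 0 = 0) : ∃ C : ℝ, 0 ≤ C ∧ ∀ᶠ t in 𝓝 0, ‖f t‖ ≤ C * ‖t‖ ^ 2 := by
  have hd := analyticAt_dslope hf hf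
  have hdd := analyticAt_dslope hd hd
  refine ⟨‖dslope (dslope f 0) 0 0‖ + 1, by positivity, ?_⟩
  filter_upwards [hdd.continuousAt.norm.eventually_lt_const (lt_add_one _)] with t ht
  have h2 := dslope_mul_sub (dslope f 0) (by rwa [dslope_same]) t
  rw [← dslope_mul_sub f h0 t, ← h2, sub_zero, norm_mul, norm_mul, mul_assoc, ← sq]
  gcongr

/-- The second order expansion at `0` of the cumulant generating function `log X(eᵗ)` and of its
derivative. -/
theorem exists_cumulant_expansion {p : PMF ℕ} (hr : 1 < pgfRadius p) :
    ∃ ρ C : ℝ, 0 < ρ ∧ 0 ≤ C ∧ ∀ t : ℂ, ‖t‖ < ρ →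
      ENNReal.ofReal ‖Complex.exp t‖ < pgfRadius p ∧
      pgf p (Complex.exp t) ∈ Complex.slitPlane ∧
      DifferentiableAt ℂ (fun t => Complex.log (pgf p (Complex.exp t))) t ∧
      ‖Complex.exp t * deriv (pgf p) (Complex.exp t) / pgf p (Complex.exp t) -
        lawMean p - lawVariance p * t‖ ≤ C * ‖t‖ ^ 2 ∧
      ‖Complex.log (pgf p (Complex.exp t)) - lawMean p * t - lawVariance p / 2 * t ^ 2‖ ≤
        C * ‖t‖ ^ 3 := by
  set X := pgf p with hX
  -- `φ` is the derivative of the cumulant generating function `g`, with φ(0) = μ and φ'(0) = σ².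
  set φ : ℂ → ℂ := fun t => Complex.exp t * deriv X (Complex.exp t) / X (Complex.exp t) with hφ
  set g : ℂ → ℂ := fun t => Complex.log (X (Complex.exp t)) with hg
  have hX1 : X (Complex.exp 0) = 1 := by rw [Complex.exp_zero, hX, pgf_one]
  have ha1 : AnalyticAt ℂ X (Complex.exp 0) := by
    rw [Complex.exp_zero]
    exact analyticAt_pgf (one_lt_radius_ofReal hr (by simp))
  have hexp : AnalyticAt ℂ Complex.exp 0 := by fun_prop
  have hXe : AnalyticAt ℂ (fun t => X (Complex.exp t)) 0 := ha1.comp hexp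
  have hX'e : AnalyticAt ℂ (fun t => deriv X (Complex.exp t)) 0 := ha1.deriv.comp hexp
  have hφa : AnalyticAt ℂ φ 0 := (hexp.mul hX'e).div hXe (by rw [hX1]; exact one_ne_zero)
  have hφ0 : φ 0 = lawMean p := by
    simp only [hφ, Complex.exp_zero]
    rw [hX, deriv_pgf_one hr, pgf_one]
    simp
  have hφ' : deriv φ 0 = lawVariance p := by
    have e0 : HasDerivAt Complex.exp 1 0 := by simpa using Complex.hasDerivAt_exp 0
    have e1 : HasDerivAt (fun t => X (Complex.exp t)) (deriv X (Complex.exp 0) * 1) 0 :=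
      ha1.differentiableAt.hasDerivAt.comp 0 e0
    have e2 : HasDerivAt (fun t => deriv X (Complex.exp t))
        (deriv (deriv X) (Complex.exp 0) * 1) 0 :=
      ha1.deriv.differentiableAt.hasDerivAt.comp 0 e0
    have e3 := ((e0.mul e2).div e1 (by rw [hX1]; exact one_ne_zero)).deriv
    refine Eq.trans e3 ?_
    simp only [hX1, Pi.mul_apply]
    rw [Complex.exp_zero, hX, deriv_pgf_one hr, deriv_deriv_pgf_one hr]
    ring
  set ψ : ℂ → ℂ := fun t => φ t - lawMean p - lawVariance p * t with hψ
  have hψa : AnalyticAt ℂ ψ 0 := (hφa.sub analyticAt_const).sub (analyticAt_const.mul analyticAt_id)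
  have hψ' : deriv ψ 0 = 0 := by
    have h := ((hφa.differentiableAt.hasDerivAt.sub_const (lawMean p : ℂ)).sub
      ((hasDerivAt_id (0 : ℂ)).const_mul (lawVariance p : ℂ))).deriv
    refine Eq.trans h ?_
    rw [hφ', mul_one, sub_self]
  obtain ⟨C, hC, hCψ⟩ := hψa.exists_norm_le_mul_norm_sq (by simp [hψ, hφ0]) hψ'
  have hrad : ∀ᶠ t in 𝓝 (0 : ℂ), ENNReal.ofReal ‖Complex.exp t‖ < pgfRadius p := by
    refine Complex.continuous_exp.continuousAt.eventually
      ((isOpen_norm_lt_radius p).mem_nhds ?_)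
    exact one_lt_radius_ofReal hr (by simp)
  have hslit : ∀ᶠ t in 𝓝 (0 : ℂ), X (Complex.exp t) ∈ Complex.slitPlane :=
    hXe.continuousAt.eventually (Complex.isOpen_slitPlane.mem_nhds
      (by simp only [hX1]; exact Complex.one_mem_slitPlane))
  obtain ⟨ρ, hρ, hball⟩ := Metric.eventually_nhds_iff_ball.1 (hrad.and (hslit.and hCψ))
  have hgd : ∀ t ∈ Metric.ball (0 : ℂ) ρ, HasDerivAt g (φ t) t := by
    intro t ht
    obtain ⟨h1, h2, -⟩ := hball t ht
    have h3 := ((differentiableAt_pgf h1).hasDerivAt.comp t (Complex.hasDerivAt_exp t)).clog h2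
    refine h3.congr_deriv ?_
    simp only [hφ, hX, Function.comp]
    ring
  refine ⟨ρ, C, hρ, hC, fun t ht => ?_⟩
  have htb : t ∈ Metric.ball (0 : ℂ) ρ := by simpa using ht
  obtain ⟨h1, h2, h3⟩ := hball t htb
  refine ⟨h1, h2, (hgd t htb).differentiableAt, h3, ?_⟩
  have hsub : Metric.closedBall (0 : ℂ) ‖t‖ ⊆ Metric.ball 0 ρ := Metric.closedBall_subset_ball ht
  -- The mean value inequality integrates the quadratic bound on the derivative into a cubic bound
  -- on `g`.
  have hmv := (convex_closedBall (0 : ℂ) ‖t‖).norm_image_sub_le_of_norm_hasDerivWithin_le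
    (f := fun t => g t - lawMean p * t - lawVariance p / 2 * t ^ 2) (f' := ψ)
    (C := C * ‖t‖ ^ 2) (x := 0) (y := t)
    (fun x hx => by
      have h4 := ((hgd x (hsub hx)).sub ((hasDerivAt_id x).const_mul (lawMean p : ℂ))).sub
        ((hasDerivAt_pow 2 x).const_mul (lawVariance p / 2 : ℂ))
      refine (h4.congr_deriv ?_).hasDerivWithinAt
      simp only [hψ]
      push_cast
      ring)
    (fun x hx => by
      have h5 : ‖x‖ ≤ ‖t‖ := by simpa using hx
      refine (hball x (hsub hx)).2.2.trans ?_
      gcongr)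
    (by simp) (by simp)
  have hg0 : g 0 = 0 := by simp only [hg, hX1, Complex.log_one]
  simp only [hg0] at hmv
  simpa [hg, pow_succ, mul_assoc] using hmv

/-- Near the root `b + w` of `w² = (y - b)²`, a perturbation of this quadratic function has a
zero. -/
theorem exists_zero_of_near_quadratic {b w : ℂ} {b₁ B : ℝ} (hb₁ : 0 < b₁) (hw : b₁ ≤ ‖w‖)
    {F : ℂ → ℂ} (hF : DifferentiableOn ℂ F (Metric.closedBall (b + w) (b₁ / 2)))
    (hFB : ∀ y ∈ Metric.closedBall (b + w) (b₁ / 2), ‖F y - (w ^ 2 - (y - b) ^ 2)‖ ≤ B)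
    (hB : 8 * B < b₁ ^ 2) : ∃ y ∈ Metric.closedBall (b + w) (b₁ / 2), F y = 0 := by
  have hη : 0 < b₁ / 2 := by positivity
  have hc : ‖F (b + w)‖ ≤ B := by
    have := hFB (b + w) (Metric.mem_closedBall_self hη.le)
    simpa using this
  -- On this circle the root b + w is at distance b₁/2 and the other root at least b₁ away, so the
  -- quadratic has modulus at least b₁²/2.
  have hsph : ∀ y ∈ Metric.sphere (b + w) (b₁ / 2),
      b₁ ^ 2 / 2 - 2 * B ≤ ‖F y - F (b + w)‖ := by
    intro y hy
    have h1 : ‖y - (b + w)‖ = b₁ / 2 := by simpa [dist_eq_norm] using hy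
    have h2 := hFB y (Metric.sphere_subset_closedBall hy)
    have h3 : b₁ ≤ ‖y - (b - w)‖ := by
      have h4 : ‖2 * w‖ ≤ ‖y - (b - w)‖ + ‖y - (b + w)‖ := by
        have : 2 * w = (y - (b - w)) - (y - (b + w)) := by ring
        rw [this]
        exact norm_sub_le _ _
      rw [norm_mul, Complex.norm_ofNat] at h4
      linarith
    have h5 : ‖w ^ 2 - (y - b) ^ 2‖ = ‖y - (b + w)‖ * ‖y - (b - w)‖ := by
      rw [← norm_mul, ← norm_neg]
      ring_nf
    have h6 : b₁ ^ 2 / 2 ≤ ‖w ^ 2 - (y - b) ^ 2‖ := by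
      rw [h5, h1]
      nlinarith
    have h7 : ‖w ^ 2 - (y - b) ^ 2‖ ≤ ‖F y - (w ^ 2 - (y - b) ^ 2)‖ + ‖F y - F (b + w)‖
        + ‖F (b + w)‖ := by
      have : w ^ 2 - (y - b) ^ 2 =
          -(F y - (w ^ 2 - (y - b) ^ 2)) + (F y - F (b + w)) + F (b + w) := by ring
      conv_lhs => rw [this]
      refine (norm_add_le _ _).trans ?_
      gcongr
      exact (norm_add_le _ _).trans_eq (by rw [norm_neg])
    linarith
  have hdc : DiffContOnCl ℂ F (Metric.ball (b + w) (b₁ / 2)) :=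
    DifferentiableOn.diffContOnCl (by rwa [closure_ball _ hη.ne'])
  have hnc : ∃ᶠ z in 𝓝 (b + w), F z ≠ F (b + w) := by
    intro hev
    have hev' : ∀ᶠ z in 𝓝 (b + w), F z = F (b + w) := hev.mono fun z hz => not_not.1 hz
    have han : AnalyticOnNhd ℂ F (Metric.ball (b + w) (b₁ / 2)) :=
      hdc.differentiableOn.analyticOnNhd Metric.isOpen_ball
    have h1 := han.eqOn_of_preconnected_of_eventuallyEq analyticOnNhd_const
      (convex_ball _ _).isPreconnected (Metric.mem_ball_self hη) hev'
    have h2 : Set.EqOn F (fun _ => F (b + w)) (Metric.closedBall (b + w) (b₁ / 2)) := by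
      rw [← closure_ball _ hη.ne']
      exact h1.of_subset_closure (by rw [closure_ball _ hη.ne']; exact hF.continuousOn)
        continuousOn_const subset_closure le_rfl
    have h3 : b + w + ((b₁ / 2 : ℝ) : ℂ) ∈ Metric.sphere (b + w) (b₁ / 2) := by
      simp [abs_of_pos hb₁]
    have h4 := hsph _ h3
    rw [h2 (Metric.sphere_subset_closedBall h3), sub_self, norm_zero] at h4
    nlinarith [norm_nonneg (F (b + w))]
  -- The quantitative open mapping theorem covers a disk of radius b₁²/4 - B about F(b + w); 8B <
  -- b₁² makes it contain 0.
  have hpos : 0 < b₁ ^ 2 / 2 - 2 * B := by nlinarith [norm_nonneg (F (b + w))]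
  have := hdc.ball_subset_image_closedBall hη hsph hnc
  have h0 : (0 : ℂ) ∈ Metric.ball (F (b + w)) ((b₁ ^ 2 / 2 - 2 * B) / 2) := by
    rw [Metric.mem_ball, dist_zero_left]
    linarith
  exact this h0

/-- A point of the right half plane which almost solves `w² = (y - b)²` is close to `b + w`. -/
theorem norm_sub_root_le {b W M B : ℝ} {k : ℤ} {w y : ℂ} (hb : 0 < b)
    (hw : w ^ 2 = (b : ℂ) ^ 2 - 2 * (Real.pi : ℂ) * Complex.I * (k : ℂ)) (hbw : b ≤ w.re)
    (hW : ‖w‖ ≤ W) (hy : 0 < y.re) (hM : ‖y‖ ≤ M)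
    (h : ‖w ^ 2 - (y - b) ^ 2‖ ≤ B * ‖y‖ ^ 2) :
    ‖y - (b + w)‖ ≤ (1 + 2 * W ^ 3 * M) * B * M := by
  have hx : w.re ≤ W := (Complex.re_le_norm w).trans hW
  have hW0 : 0 < W := by linarith
  have hyn : 0 < ‖y‖ := hy.trans_le (Complex.re_le_norm y)
  have hM0 : 0 < M := hyn.trans_le hM
  have hre : w.re ^ 2 - w.im ^ 2 = b ^ 2 := by
    have := congrArg Complex.re hw
    simpa [sq] using this
  have him : w.re * w.im = -(Real.pi * k) := by
    have := congrArg Complex.im hw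
    simp [sq] at this
    linarith
  have hB : 0 ≤ B := by
    have := (norm_nonneg _).trans h
    exact nonneg_of_mul_nonneg_left this (by positivity)
  -- For k = 0 the second root b - w is 0 and the bound is immediate. For k ≠ 0 the imaginary part
  -- of w is bounded below, which forces Re w - b ≥ 1/(2W³) and keeps y, having Re y > 0, away from
  -- b - w.
  have key : ‖y‖ ≤ (1 + 2 * W ^ 3 * M) * ‖y - (b - w)‖ := by
    by_cases hk : k = 0
    · subst hk
      have him0 : w.im = 0 := by
        have h1 : w.re * w.im = 0 := by simpa using him
        exact (mul_eq_zero.1 h1).resolve_left (by linarith)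
      have hre0 : w.re = b := by
        rw [him0] at hre
        nlinarith
      have hwb : w = b := Complex.ext (by simpa using hre0) (by simpa using him0)
      rw [hwb, sub_self, sub_zero]
      have : 0 ≤ 2 * W ^ 3 * M * ‖y‖ := by positivity
      linarith
    · have hk1 : (1 : ℝ) ≤ |(k : ℝ)| := by
        exact_mod_cast Int.one_le_abs hk
      have h1 : 1 ≤ W * |w.im| := by
        have h2 : w.re * |w.im| = Real.pi * |(k : ℝ)| := by
          have := congrArg abs him
          rwa [abs_mul, abs_neg, abs_mul, abs_of_pos Real.pi_pos,
            abs_of_pos (show 0 < w.re by linarith)] at this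
        have h3 : w.re * |w.im| ≤ W * |w.im| := by gcongr
        nlinarith [Real.pi_gt_three]
      have h4 : 1 ≤ W ^ 2 * w.im ^ 2 := by
        rw [← sq_abs w.im, ← mul_pow]
        exact one_le_pow₀ h1
      have h5 : 1 ≤ 2 * W ^ 3 * (w.re - b) := by
        have h6 : w.im ^ 2 = (w.re - b) * (w.re + b) := by linarith
        have h7 : (w.re - b) * (w.re + b) ≤ (w.re - b) * (2 * W) := by
          refine mul_le_mul_of_nonneg_left ?_ ?_ <;> linarith
        calc (1 : ℝ) ≤ W ^ 2 * w.im ^ 2 := h4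
          _ ≤ W ^ 2 * ((w.re - b) * (2 * W)) := by rw [h6]; gcongr
          _ = _ := by ring
      have h8 : w.re - b ≤ ‖y - (b - w)‖ := by
        refine le_trans ?_ (Complex.re_le_norm _)
        simp
        linarith
      have h9 : 0 ≤ ‖y - (b - w)‖ := norm_nonneg _
      calc ‖y‖ ≤ M * 1 := by linarith
        _ ≤ M * (2 * W ^ 3 * (w.re - b)) := by gcongr
        _ ≤ M * (2 * W ^ 3 * ‖y - (b - w)‖) := by gcongr
        _ ≤ _ := by linarith
  have hfac : ‖w ^ 2 - (y - b) ^ 2‖ = ‖y - (b + w)‖ * ‖y - (b - w)‖ := by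
    rw [← norm_mul, ← norm_neg]
    ring_nf
  rw [hfac] at h
  have hL : 0 ≤ 1 + 2 * W ^ 3 * M := by positivity
  have h10 : ‖y - (b + w)‖ * ‖y‖ ≤ ((1 + 2 * W ^ 3 * M) * B * ‖y‖) * ‖y‖ := by
    calc ‖y - (b + w)‖ * ‖y‖ ≤ ‖y - (b + w)‖ * ((1 + 2 * W ^ 3 * M) * ‖y - (b - w)‖) := by gcongr
      _ = (1 + 2 * W ^ 3 * M) * (‖y - (b + w)‖ * ‖y - (b - w)‖) := by ring
      _ ≤ (1 + 2 * W ^ 3 * M) * (B * ‖y‖ ^ 2) := by gcongr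
      _ = _ := by ring
  refine (le_of_mul_le_mul_right h10 hyn).trans ?_
  gcongr

/-! ### The principal square root of b₀² - 2πik -/

theorem sq_cpow_half (z : ℂ) : (z ^ (1 / 2 : ℂ)) ^ 2 = z := by
  rw [one_div]
  exact_mod_cast Complex.cpow_nat_inv_pow z two_ne_zero

theorem re_cpow_half_nonneg (z : ℂ) : 0 ≤ (z ^ (1 / 2 : ℂ)).re := by
  by_cases hz : z = 0
  · simp [hz]
  · rw [Complex.cpow_def_of_ne_zero hz, Complex.exp_re]
    refine mul_nonneg (Real.exp_pos _).le (Real.cos_nonneg_of_mem_Icc ?_)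
    have h1 := Complex.neg_pi_lt_arg z
    have h2 := Complex.arg_le_pi z
    have h3 : (Complex.log z * (1 / 2)).im = z.arg / 2 := by
      rw [show (1 / 2 : ℂ) = ((1 / 2 : ℝ) : ℂ) by push_cast; rfl, Complex.im_mul_ofReal,
        Complex.log_im]
      ring
    rw [h3]
    constructor <;> linarith

theorem rootK_sq (p : PMF ℕ) (γ : ℝ) (k : ℤ) :
    rootK p γ k ^ 2 = (bZero p γ : ℂ) ^ 2 - 2 * (Real.pi : ℂ) * Complex.I * (k : ℂ) :=
  sq_cpow_half _

/-- Taking real parts of w² gives (Re w)² = b₀² + (Im w)², and the principal root has Re w ≥ 0. -/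
theorem bZero_le_re_rootK (p : PMF ℕ) (γ : ℝ) (k : ℤ) :
    bZero p γ ≤ (rootK p γ k).re := by
  have h0 : 0 ≤ (rootK p γ k).re := re_cpow_half_nonneg _
  have hre : (rootK p γ k).re ^ 2 - (rootK p γ k).im ^ 2 = bZero p γ ^ 2 := by
    have := congrArg Complex.re (rootK_sq p γ k)
    simpa [sq] using this
  exact abs_le_of_sq_le_sq' (by nlinarith [sq_nonneg (rootK p γ k).im]) h0 |>.2

theorem norm_rootK_le {p : PMF ℕ} {γ b₂ : ℝ} {k : ℤ} {K : ℕ} (hb : 0 ≤ bZero p γ)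
    (hb₂ : bZero p γ ≤ b₂) (hk : |k| ≤ (K : ℤ)) :
    ‖rootK p γ k‖ ≤ b₂ + 2 * Real.pi * K + 1 := by
  have hK : |(k : ℝ)| ≤ K := by exact_mod_cast hk
  have hpi := Real.pi_pos
  have hKK : 0 ≤ 2 * Real.pi * (K : ℝ) := by positivity
  have h1 : ‖rootK p γ k‖ ^ 2 ≤ b₂ ^ 2 + 2 * Real.pi * K := by
    rw [← norm_pow, rootK_sq]
    refine (norm_sub_le _ _).trans ?_
    have h2 : ‖(bZero p γ : ℂ) ^ 2‖ ≤ b₂ ^ 2 := by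
      rw [norm_pow, Complex.norm_real, Real.norm_of_nonneg hb]
      gcongr
    have h3 : ‖2 * (Real.pi : ℂ) * Complex.I * (k : ℂ)‖ ≤ 2 * Real.pi * K := by
      simp only [norm_mul, Complex.norm_I, Complex.norm_ofNat, Complex.norm_real, mul_one,
        Complex.norm_intCast, Real.norm_of_nonneg hpi.le]
      gcongr
    linarith
  refine abs_le_of_sq_le_sq' (h1.trans ?_) (by linarith) |>.2
  nlinarith

/-! ### Asymptotics of the outer zeros -/

section Scaling

variable {μ v A b γ γ₂ δ C M s n : ℝ} {y : ℂ}

/-- As nδ² ≤ 1/μ, a cubic error in t = Aδy costs only one δ. One factor |y| is bounded by M; the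
other two are kept for the cancellation at y = 0. -/
theorem mul_cube_scaled_le (hμ : 0 < μ) (hsδ : s * δ ^ 2 = 1) (hδ : 0 < δ)
    (hn : n * μ = s * (1 - γ * δ)) (hA : 0 < A) (hγ : 0 ≤ γ) (hC : 0 ≤ C) (hy : ‖y‖ ≤ M) :
    n * (C * ‖((A * δ : ℝ) : ℂ) * y‖ ^ 3) ≤ C * A ^ 3 * M / μ * δ * ‖y‖ ^ 2 := by
  have h1 : n * δ ^ 2 ≤ 1 / μ := by
    rw [le_div_iff₀ hμ]
    have h2 : n * δ ^ 2 * μ = 1 - γ * δ := by linear_combination δ ^ 2 * hn + (1 - γ * δ) * hsδ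
    nlinarith
  have h3 : ‖((A * δ : ℝ) : ℂ) * y‖ = A * δ * ‖y‖ := by
    rw [norm_mul, Complex.norm_real, Real.norm_of_nonneg (by positivity)]
  rw [h3]
  calc n * (C * (A * δ * ‖y‖) ^ 3) = C * A ^ 3 * δ * ‖y‖ ^ 2 * (n * δ ^ 2 * ‖y‖) := by ring
    _ ≤ C * A ^ 3 * δ * ‖y‖ ^ 2 * (1 / μ * M) := by gcongr
    _ = _ := by ring

/-- The linear term is (s - nμ)Aδy = γAy = 2by. The normalization vA² = 2μ makes the quadratic term
(1 - γδ)y², whose defect γδy² joins the cubic remainder. -/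
theorem norm_scaled_equation_sub_le (hμ : 0 < μ) (hsδ : s * δ ^ 2 = 1) (hδ : 0 < δ)
    (hn : n * μ = s * (1 - γ * δ)) (hn0 : 0 ≤ n) (hA : 0 < A) (hvA : v * A ^ 2 = 2 * μ)
    (hγA : γ * A = 2 * b) (hγ : 0 ≤ γ) (hγ₂ : γ ≤ γ₂) (hC : 0 ≤ C) (hy : ‖y‖ ≤ M) {g : ℂ}
    (hg : ‖g - μ * (((A * δ : ℝ) : ℂ) * y) - v / 2 * (((A * δ : ℝ) : ℂ) * y) ^ 2‖ ≤
      C * ‖((A * δ : ℝ) : ℂ) * y‖ ^ 3) :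
    ‖s * (((A * δ : ℝ) : ℂ) * y) - n * g - (2 * b * y - y ^ 2)‖ ≤
      (γ₂ + C * A ^ 3 * M / μ) * δ * ‖y‖ ^ 2 := by
  have c1 : (s : ℂ) * δ ^ 2 = 1 := by exact_mod_cast hsδ
  have c2 : (n : ℂ) * μ = s * (1 - γ * δ) := by exact_mod_cast hn
  have c3 : (v : ℂ) * A ^ 2 = 2 * μ := by exact_mod_cast hvA
  have c4 : (γ : ℂ) * A = 2 * b := by exact_mod_cast hγA
  have hid : s * (((A * δ : ℝ) : ℂ) * y) - n * g - (2 * b * y - y ^ 2) = γ * δ * y ^ 2 -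
      n * (g - μ * (((A * δ : ℝ) : ℂ) * y) - v / 2 * (((A * δ : ℝ) : ℂ) * y) ^ 2) := by
    push_cast
    linear_combination (-(A * δ * y) - δ ^ 2 * y ^ 2) * c2 +
      (γ * A * y - (1 - γ * δ) * y ^ 2) * c1 + y * c4 - n / 2 * δ ^ 2 * y ^ 2 * c3
  rw [hid]
  refine (norm_sub_le _ _).trans ?_
  have e1 : ‖(γ : ℂ) * δ * y ^ 2‖ ≤ γ₂ * δ * ‖y‖ ^ 2 := by
    rw [norm_mul, norm_mul, norm_pow, Complex.norm_real, Complex.norm_real,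
      Real.norm_of_nonneg hγ, Real.norm_of_nonneg hδ.le]
    gcongr
  have e2 := mul_cube_scaled_le (y := y) hμ hsδ hδ hn hA hγ hC hy
  rw [norm_mul (n : ℂ), Complex.norm_real, Real.norm_of_nonneg hn0]
  have e3 := mul_le_mul_of_nonneg_left hg hn0
  linarith

/-- With f the derivative of the cumulant function, t(s - nf) is y d/dy applied to the scaled
equation, and y d/dy maps 2by - y² to 2by - 2y². -/
theorem norm_scaled_derivative_sub_le (hμ : 0 < μ) (hsδ : s * δ ^ 2 = 1) (hδ : 0 < δ)
    (hn : n * μ = s * (1 - γ * δ)) (hn0 : 0 ≤ n) (hA : 0 < A) (hvA : v * A ^ 2 = 2 * μ)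
    (hγA : γ * A = 2 * b) (hγ : 0 ≤ γ) (hγ₂ : γ ≤ γ₂) (hC : 0 ≤ C) (hy : ‖y‖ ≤ M) {f : ℂ}
    (hf : ‖f - μ - v * (((A * δ : ℝ) : ℂ) * y)‖ ≤ C * ‖((A * δ : ℝ) : ℂ) * y‖ ^ 2) :
    ‖((A * δ : ℝ) : ℂ) * y * (s - n * f) - (2 * b * y - 2 * y ^ 2)‖ ≤
      2 * (γ₂ + C * A ^ 3 * M / μ) * δ * ‖y‖ ^ 2 := by
  have c1 : (s : ℂ) * δ ^ 2 = 1 := by exact_mod_cast hsδ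
  have c2 : (n : ℂ) * μ = s * (1 - γ * δ) := by exact_mod_cast hn
  have c3 : (v : ℂ) * A ^ 2 = 2 * μ := by exact_mod_cast hvA
  have c4 : (γ : ℂ) * A = 2 * b := by exact_mod_cast hγA
  have hid : ((A * δ : ℝ) : ℂ) * y * (s - n * f) - (2 * b * y - 2 * y ^ 2) =
      2 * (γ * δ * y ^ 2) -
      n * ((((A * δ : ℝ) : ℂ) * y) * (f - μ - v * (((A * δ : ℝ) : ℂ) * y))) := by
    push_cast
    linear_combination (-(A * δ * y) - 2 * δ ^ 2 * y ^ 2) * c2 +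
      (γ * A * y - 2 * (1 - γ * δ) * y ^ 2) * c1 + y * c4 - n * δ ^ 2 * y ^ 2 * c3
  rw [hid]
  refine (norm_sub_le _ _).trans ?_
  have e1 : ‖2 * ((γ : ℂ) * δ * y ^ 2)‖ ≤ 2 * (γ₂ * δ * ‖y‖ ^ 2) := by
    rw [norm_mul, norm_mul, norm_mul, norm_pow, Complex.norm_real, Complex.norm_real,
      Real.norm_of_nonneg hγ, Real.norm_of_nonneg hδ.le, Complex.norm_ofNat]
    gcongr
  have e2 := mul_cube_scaled_le (y := y) hμ hsδ hδ hn hA hγ hC hy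
  have e4 : 0 ≤ C * A ^ 3 * M / μ * δ * ‖y‖ ^ 2 := by
    have := (norm_nonneg y).trans hy
    positivity
  rw [norm_mul (n : ℂ), Complex.norm_real, Real.norm_of_nonneg hn0, norm_mul (((A * δ : ℝ) : ℂ) * y)]
  have e3 : n * (‖((A * δ : ℝ) : ℂ) * y‖ * ‖f - μ - v * (((A * δ : ℝ) : ℂ) * y)‖) ≤
      n * (C * ‖((A * δ : ℝ) : ℂ) * y‖ ^ 3) := by
    refine mul_le_mul_of_nonneg_left ?_ hn0
    calc _ ≤ ‖((A * δ : ℝ) : ℂ) * y‖ * (C * ‖((A * δ : ℝ) : ℂ) * y‖ ^ 2) := by gcongr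
      _ = _ := by ring
  linarith

end Scaling

/-- A small solution in the right half plane of the `k`-th branch equation, in the variable
`t = log z`, is an outer zero on the `k`-th branch. -/
theorem isOuterZeroOnBranch_exp {p : PMF ℕ} {n s : ℕ} {k : ℤ} {t : ℂ} (ht : ‖t‖ ≤ 1)
    (hre : 0 < t.re) (hrad : ENNReal.ofReal ‖Complex.exp t‖ < pgfRadius p)
    (hX : pgf p (Complex.exp t) ≠ 0)
    (h : (s : ℂ) * t - n * Complex.log (pgf p (Complex.exp t)) -
      2 * (Real.pi : ℂ) * Complex.I * (k : ℂ) = 0) :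
    IsOuterZeroOnBranch p n s k (Complex.exp t) := by
  have him := (Complex.abs_im_le_norm t).trans ht
  rw [abs_le] at him
  have hpi := Real.pi_gt_three
  refine ⟨isOuterZero_iff.2 ⟨?_, hrad, ?_⟩, ?_⟩
  · rw [Complex.norm_exp]
    exact Real.one_lt_exp_iff.2 hre
  · have h1 : (s : ℂ) * t = n * Complex.log (pgf p (Complex.exp t)) +
        k * (2 * Real.pi * Complex.I) := by
      linear_combination h
    rw [charFun, ← Complex.exp_nat_mul, h1, Complex.exp_add, Complex.exp_int_mul_two_pi_mul_I,
      mul_one, Complex.exp_nat_mul, Complex.exp_log hX, sub_self]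
  · rw [Complex.log_exp (by linarith) (by linarith)]
    linear_combination h

set_option maxHeartbeats 1600000 in
/-- The derivative factor at the outer zero `Z_k`, to leading order. -/
theorem exists_outerZero_estimate {p : PMF ℕ} (hr : 1 < pgfRadius p) (hμ : 0 < lawMean p)
    (hv : 0 < lawVariance p) {γ₁ γ₂ : ℝ} (hγ₁ : 0 < γ₁) (hγ₁₂ : γ₁ ≤ γ₂) (K : ℕ) :
    ∃ C b₁ : ℝ, ∃ s₀ : ℕ, 0 < C ∧ 0 < b₁ ∧ ∀ s n : ℕ, s₀ ≤ s → ∀ γ : ℝ, γ₁ ≤ γ → γ ≤ γ₂ →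
      (n : ℝ) * lawMean p / (s : ℝ) = 1 - γ / √(s : ℝ) →
      0 < √(s : ℝ) ∧ C / √(s : ℝ) ≤ b₁ ^ 2 ∧ n ≠ 0 ∧ n * lawMean p < s ∧
      b₁ ≤ bZero p γ ∧
      ∀ k : ℤ, |k| ≤ (K : ℤ) → ∀ Z : ℂ, IsOuterZeroOfIndex p n s k Z →
      pgf p Z ≠ 0 ∧
      ‖(1 - Z) * (s / Z - n * deriv (pgf p) Z / pgf p Z) -
        2 * rootK p γ k * ((bZero p γ : ℂ) + rootK p γ k)‖ ≤ C / √(s : ℝ) := by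
  obtain ⟨ρ, C, hρ, hC, hexpand⟩ := exists_cumulant_expansion hr
  set μ := lawMean p
  set v := lawVariance p
  obtain ⟨c, hc⟩ : ∃ x : ℝ, x = √μ / (√v * √2) := ⟨_, rfl⟩
  have hc0 : 0 < c := by rw [hc]; positivity
  have hc2 : v * (2 * c) ^ 2 = 2 * μ := by
    rw [hc, mul_pow, div_pow, mul_pow, Real.sq_sqrt hμ.le, Real.sq_sqrt hv.le,
      Real.sq_sqrt zero_le_two]
    field_simp
  have hbγ : ∀ γ, bZero p γ = γ * c := fun γ => by
    rw [bZero, hc, mul_div_assoc]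
  obtain ⟨A, hA⟩ : ∃ x : ℝ, x = 2 * c := ⟨_, rfl⟩
  rw [← hA] at hc2
  have hA0 : 0 < A := by rw [hA]; positivity
  obtain ⟨b₁, hb₁⟩ : ∃ x : ℝ, x = γ₁ * c := ⟨_, rfl⟩
  have hb₁0 : 0 < b₁ := by rw [hb₁]; positivity
  have hγ₂0 : 0 < γ₂ := hγ₁.trans_le hγ₁₂
  obtain ⟨b₂, hb₂⟩ : ∃ x : ℝ, x = γ₂ * c := ⟨_, rfl⟩
  have hb₂0 : 0 < b₂ := by rw [hb₂]; positivity
  obtain ⟨W, hW⟩ : ∃ x : ℝ, x = b₂ + 2 * Real.pi * K + 1 := ⟨_, rfl⟩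
  have hpi := Real.pi_pos
  have hW0 : 0 < W := by rw [hW]; positivity
  -- `M` bounds |y| on the disk where a zero is constructed. `M'` is 3M because |eᵗ - 1| ≤ 2|t| and
  -- |ln Z| ≤ (3/2)|Z - 1| lose a factor 3 when the bound passes to Z_k.
  obtain ⟨M, hM⟩ : ∃ x : ℝ, x = b₂ + W + b₁ := ⟨_, rfl⟩
  have hM0 : 0 < M := by rw [hM]; positivity
  obtain ⟨M', hM'⟩ : ∃ x : ℝ, x = 3 * M := ⟨_, rfl⟩
  have hM'0 : 0 < M' := by rw [hM']; positivity
  obtain ⟨C₁, hC₁⟩ : ∃ x : ℝ, x = γ₂ + C * A ^ 3 * M' / μ := ⟨_, rfl⟩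
  have hC₁0 : 0 < C₁ := by rw [hC₁]; positivity
  obtain ⟨C₂, hC₂⟩ : ∃ x : ℝ, x = (1 + 2 * W ^ 3 * M') * C₁ * M' := ⟨_, rfl⟩
  have hC₂0 : 0 < C₂ := by rw [hC₂]; positivity
  obtain ⟨C₃, hC₃⟩ : ∃ x : ℝ, x = 2 * C₁ * M' ^ 2 + 2 * b₂ * M' + 2 * M' ^ 2 := ⟨_, rfl⟩
  have hC₃0 : 0 < C₃ := by rw [hC₃]; positivity
  obtain ⟨C₄, hC₄⟩ : ∃ x : ℝ, x = A * M' * C₃ + 2 * C₁ * M' ^ 2 + 2 * C₂ * (M' + W) := ⟨_, rfl⟩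
  have hC₄0 : 0 < C₄ := by rw [hC₄]; positivity
  -- Each summand encodes one smallness condition on δ; all are positive, so T δ ≤ 1 implies every
  -- one of them.
  obtain ⟨T, hT⟩ : ∃ x : ℝ, x = 1 + 2 * (A * M') + 2 * (A * M' / ρ) + 9 * (C₁ * M ^ 2) / b₁ ^ 2 + C₄ / b₁ ^ 2 +
    2 * γ₂ := ⟨_, rfl⟩
  have t1 : 0 < A * M' := by positivity
  have t2 : 0 < A * M' / ρ := by positivity
  have t3 : 0 < 9 * (C₁ * M ^ 2) / b₁ ^ 2 := by positivity
  have t4 : 0 < C₄ / b₁ ^ 2 := by positivity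
  refine ⟨C₄, b₁, ⌈T ^ 2⌉₊ + 1, hC₄0, hb₁0, ?_⟩
  intro s n hs γ hγ hγ' heq
  have hsT : T ^ 2 ≤ s := (Nat.le_ceil _).trans (by exact_mod_cast (Nat.le_succ _).trans hs)
  have hs0 : (0 : ℝ) < s := by
    have : 0 < s := by omega
    exact_mod_cast this
  have hsq : 0 < √(s : ℝ) := Real.sqrt_pos.2 hs0
  obtain ⟨δ, hδ⟩ : ∃ x : ℝ, x = 1 / √(s : ℝ) := ⟨_, rfl⟩
  have hδ0 : 0 < δ := by rw [hδ]; positivity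
  have hTδ : T * δ ≤ 1 := by
    rw [hδ, mul_one_div, div_le_one hsq]
    exact Real.le_sqrt_of_sq_le hsT
  have hsδ : (s : ℝ) * δ ^ 2 = 1 := by
    rw [hδ, div_pow, one_pow, Real.sq_sqrt hs0.le]
    field_simp
  have hle : ∀ x, x ≤ T → x * δ ≤ 1 := fun x hx =>
    (mul_le_mul_of_nonneg_right hx hδ0.le).trans hTδ
  have d1 : δ ≤ 1 := by simpa using hle 1 (by linarith)
  have d2 : 2 * (A * M') * δ ≤ 1 := hle _ (by linarith)
  have d3 : 2 * (A * M' / ρ) * δ ≤ 1 := hle _ (by linarith)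
  have d4 : 9 * (C₁ * M ^ 2) / b₁ ^ 2 * δ ≤ 1 := hle _ (by linarith)
  have d5 : C₄ / b₁ ^ 2 * δ ≤ 1 := hle _ (by linarith)
  have d6 : 2 * γ₂ * δ ≤ 1 := hle _ (by linarith)
  have d3' : A * δ * M' < ρ := by
    rw [mul_div_assoc', div_mul_eq_mul_div, div_le_one hρ] at d3
    have : 0 < A * δ * M' := by positivity
    linarith
  have d4' : 8 * (C₁ * δ * M ^ 2) < b₁ ^ 2 := by
    rw [div_mul_eq_mul_div, div_le_one (by positivity)] at d4
    have : 0 < C₁ * δ * M ^ 2 := by positivity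
    linarith
  have d5' : C₄ * δ ≤ b₁ ^ 2 := by
    rwa [div_mul_eq_mul_div, div_le_one (by positivity)] at d5
  have hγ0 : 0 < γ := hγ₁.trans_le hγ
  have hγδ : γ * δ ≤ γ₂ * δ := by gcongr
  have hγδ0 : 0 < γ * δ := by positivity
  have hn : (n : ℝ) * μ = s * (1 - γ * δ) := by
    rw [div_eq_iff hs0.ne'] at heq
    rw [heq, hδ]
    ring
  have hn0 : n ≠ 0 := by
    rintro rfl
    have h1 : (s : ℝ) * (1 - γ * δ) = 0 := by rw [← hn]; simp
    have h2 : 0 < (s : ℝ) * (1 - γ * δ) := mul_pos hs0 (by linarith)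
    linarith
  have hdrift : (n : ℝ) * μ < s := by
    rw [hn]
    have := mul_pos hs0 hγδ0
    linarith
  set b := bZero p γ with hb
  have hb1 : b₁ ≤ b := by rw [hb, hbγ, hb₁]; gcongr
  have hb2 : b ≤ b₂ := by rw [hb, hbγ, hb₂]; gcongr
  have hb0 : 0 < b := hb₁0.trans_le hb1
  have hγA : γ * A = 2 * b := by rw [hb, hbγ, hA]; ring
  have hnn : (0 : ℝ) ≤ n := n.cast_nonneg
  rw [← mul_one_div, ← hδ]
  refine ⟨hsq, d5', hn0, hdrift, hb1, ?_⟩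
  intro k hk Z hZ
  set w := rootK p γ k with hw
  have hw2 : w ^ 2 = (b : ℂ) ^ 2 - 2 * (Real.pi : ℂ) * Complex.I * (k : ℂ) := rootK_sq p γ k
  have hbw : b ≤ w.re := bZero_le_re_rootK p γ k
  have hwW : ‖w‖ ≤ W := (norm_rootK_le hb0.le hb2 hk).trans_eq hW.symm
  have hbn : ‖(b : ℂ)‖ = b := by rw [Complex.norm_real, Real.norm_of_nonneg hb0.le]
  have htn : ∀ y : ℂ, ‖((A * δ : ℝ) : ℂ) * y‖ = A * δ * ‖y‖ := fun y => by
    rw [norm_mul, Complex.norm_real, Real.norm_of_nonneg (by positivity)]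
  have htρ : ∀ y : ℂ, ‖y‖ ≤ M' → ‖((A * δ : ℝ) : ℂ) * y‖ < ρ := fun y hy => by
    rw [htn]
    exact (mul_le_mul_of_nonneg_left hy (by positivity)).trans_lt d3'
  set F : ℂ → ℂ := fun y => (s : ℂ) * (((A * δ : ℝ) : ℂ) * y) -
    n * Complex.log (pgf p (Complex.exp (((A * δ : ℝ) : ℂ) * y))) -
    2 * (Real.pi : ℂ) * Complex.I * (k : ℂ) with hF
  have hFB : ∀ y : ℂ, ‖y‖ ≤ M' → ‖F y - (w ^ 2 - (y - b) ^ 2)‖ ≤ C₁ * δ * ‖y‖ ^ 2 := by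
    intro y hy
    have h1 := norm_scaled_equation_sub_le hμ hsδ hδ0 hn hnn hA0 hc2 hγA hγ0.le hγ' hC hy
      (hexpand _ (htρ y hy)).2.2.2.2
    rw [← hC₁] at h1
    have h2 : F y - (w ^ 2 - (y - b) ^ 2) = ((s : ℝ) : ℂ) * (((A * δ : ℝ) : ℂ) * y) -
        ((n : ℝ) : ℂ) * Complex.log (pgf p (Complex.exp (((A * δ : ℝ) : ℂ) * y))) -
        (2 * b * y - y ^ 2) := by
      rw [hF, hw2]
      push_cast
      ring
    rw [h2]
    exact h1
  -- a zero near `1` exists on the branch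
  have hball : ∀ y ∈ Metric.closedBall ((b : ℂ) + w) (b₁ / 2), ‖y‖ ≤ M ∧ 0 < y.re := by
    intro y hy
    have h1 : ‖y - (b + w)‖ ≤ b₁ / 2 := by simpa [dist_eq_norm] using hy
    have h2 : ‖y‖ ≤ ‖y - (b + w)‖ + ‖(b : ℂ) + w‖ := by
      simpa using norm_add_le (y - (b + w)) (b + w)
    have h3 : ‖(b : ℂ) + w‖ ≤ b + ‖w‖ := (norm_add_le _ _).trans_eq (by rw [hbn])
    have h4 := (Complex.abs_re_le_norm (y - (b + w))).trans h1
    rw [abs_le] at h4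
    have h5 : (y - (b + w)).re = y.re - (b + w.re) := by simp
    rw [h5] at h4
    constructor <;> linarith
  obtain ⟨y₀, hy₀, hFy₀⟩ := exists_zero_of_near_quadratic (b := (b : ℂ)) (w := w)
    (B := C₁ * δ * M ^ 2) hb₁0 (hb1.trans (hbw.trans (Complex.re_le_norm w))) (F := F)
    (fun y hy => by
      have h1 := (hexpand _ (htρ y ((hball y hy).1.trans (by linarith)))).2.2.1
      have h2 : DifferentiableAt ℂ (fun y : ℂ => ((A * δ : ℝ) : ℂ) * y) y := by fun_prop
      have h3 := DifferentiableAt.comp y h1 h2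
      exact (((h2.const_mul _).sub (h3.const_mul _)).sub_const _).differentiableWithinAt)
    (fun y hy => by
      have h1 := (hball y hy).1
      refine (hFB y (h1.trans (by linarith))).trans ?_
      gcongr)
    d4'
  obtain ⟨hy₀M, hy₀re⟩ := hball y₀ hy₀
  have ht₀ : ‖((A * δ : ℝ) : ℂ) * y₀‖ ≤ A * δ * M := by
    rw [htn]
    gcongr
  have hMM : A * δ * M' = 3 * (A * δ * M) := by rw [hM']; ring
  have hAδM : A * δ * M ≤ 1 / 6 := by linarith
  have hbr : IsOuterZeroOnBranch p n s k (Complex.exp (((A * δ : ℝ) : ℂ) * y₀)) := by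
    have h1 := hexpand _ (htρ y₀ (hy₀M.trans (by linarith)))
    refine isOuterZeroOnBranch_exp (by linarith) ?_ h1.1 (Complex.slitPlane_ne_zero h1.2.1) hFy₀
    rw [Complex.re_ofReal_mul]
    positivity
  -- Z is no farther from 1 than the zero just constructed; this is the only use of its minimality.
  have hZ1 : ‖Z - 1‖ ≤ 2 * (A * δ * M) := by
    refine (hZ.2 _ hbr).trans ((Complex.norm_exp_sub_one_le (by linarith)).trans ?_)
    gcongr
  -- the rescaled logarithm of `Z`
  set t := Complex.log Z with ht
  have hZ0 : Z ≠ 0 := by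
    rintro rfl
    have := hZ.1.1.1
    simp at this
    linarith
  have het : Complex.exp t = Z := Complex.exp_log hZ0
  have htM : ‖t‖ ≤ A * δ * M' := by
    have h1 := Complex.norm_log_one_add_half_le_self (z := Z - 1) (by linarith)
    rw [add_sub_cancel] at h1
    rw [ht]
    linarith
  have hAδ : ((A * δ : ℝ) : ℂ) ≠ 0 := by
    have : 0 < A * δ := by positivity
    exact_mod_cast this.ne'
  obtain ⟨y, hty⟩ : ∃ y : ℂ, ((A * δ : ℝ) : ℂ) * y = t :=
    ⟨t / ((A * δ : ℝ) : ℂ), mul_div_cancel₀ _ hAδ⟩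
  have hyM : ‖y‖ ≤ M' := by
    rw [← hty, htn] at htM
    exact le_of_mul_le_mul_left htM (by positivity)
  have hyre : 0 < y.re := by
    have h1 : 0 < t.re := by
      rw [ht, Complex.log_re]
      exact Real.log_pos hZ.1.1.1
    rw [← hty, Complex.re_ofReal_mul] at h1
    exact pos_of_mul_pos_right h1 (by positivity)
  have hFy : F y = 0 := by
    simp only [hF]
    rw [hty, het]
    linear_combination hZ.1.2
  have hquad : ‖w ^ 2 - (y - b) ^ 2‖ ≤ C₁ * δ * ‖y‖ ^ 2 := by
    have h1 := hFB y hyM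
    rwa [hFy, zero_sub, norm_neg] at h1
  have hclose : ‖y - (b + w)‖ ≤ C₂ * δ := by
    refine (norm_sub_root_le hb0 hw2 hbw hwW hyre hyM hquad).trans_eq ?_
    rw [hC₂]
    ring
  have hexp := hexpand t (by rw [← hty]; exact htρ y hyM)
  rw [het] at hexp
  have hX0 : pgf p Z ≠ 0 := Complex.slitPlane_ne_zero hexp.2.1
  refine ⟨hX0, ?_⟩
  set f : ℂ := Z * deriv (pgf p) Z / pgf p Z with hf
  set P : ℂ := t * (s - n * f) with hP
  have hP1 : ‖P - (2 * b * y - 2 * y ^ 2)‖ ≤ 2 * C₁ * δ * M' ^ 2 := by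
    have h1 := norm_scaled_derivative_sub_le hμ hsδ hδ0 hn hnn hA0 hc2 hγA hγ0.le hγ' hC hyM
      (f := f) (by rw [hty]; exact hexp.2.2.2.1)
    rw [hty, ← hC₁] at h1
    refine (le_trans (le_of_eq ?_) h1).trans ?_
    · simp [hP]
    · gcongr
  have hP2 : ‖P‖ ≤ C₃ := by
    have h1 : ‖P‖ ≤ ‖P - (2 * b * y - 2 * y ^ 2)‖ + ‖2 * b * y - 2 * y ^ 2‖ := by
      have := norm_add_le (P - (2 * b * y - 2 * y ^ 2)) (2 * b * y - 2 * y ^ 2)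
      rwa [sub_add_cancel] at this
    have h2 : ‖2 * b * y - 2 * y ^ 2‖ ≤ 2 * b₂ * M' + 2 * M' ^ 2 := by
      refine (norm_sub_le _ _).trans ?_
      rw [norm_mul, norm_mul, norm_mul, norm_pow, hbn, Complex.norm_ofNat]
      gcongr
    have h3 : 2 * C₁ * δ * M' ^ 2 ≤ 2 * C₁ * 1 * M' ^ 2 := by gcongr
    linarith
  -- With Z = eᵗ, the factor 1/Z turns 1 - Z into e⁻ᵗ - 1, which is -t to first order; the product
  -- is therefore close to -P.
  have hden : (1 - Z) * (s / Z - n * deriv (pgf p) Z / pgf p Z) =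
      (Complex.exp (-t) - 1) * (s - n * f) := by
    rw [Complex.exp_neg, het, hf]
    field_simp
  -- The error of e⁻ᵗ - 1 + t is O(t²); one factor t combines with s - nf into the bounded quantity
  -- P, the other is O(δ).
  have hD1 : ‖(Complex.exp (-t) - 1) * (s - n * f) + P‖ ≤ A * δ * M' * C₃ := by
    have h1 : (Complex.exp (-t) - 1) * (s - n * f) + P =
        (Complex.exp (-t) - 1 - -t) * (s - n * f) := by rw [hP]; ring
    have h2 := Complex.norm_exp_sub_one_sub_id_le (x := -t) (by rw [norm_neg]; linarith)
    rw [h1, norm_mul]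
    calc _ ≤ ‖-t‖ ^ 2 * ‖(s : ℂ) - n * f‖ := by gcongr
      _ = ‖t‖ * ‖P‖ := by rw [norm_neg, hP, norm_mul]; ring
      _ ≤ _ := by gcongr
  have hD2 : ‖2 * b * y - 2 * y ^ 2 + 2 * w * (b + w)‖ ≤ 2 * (C₂ * δ) * (M' + W) := by
    have h1 : 2 * b * y - 2 * y ^ 2 + 2 * w * (b + w) = -(2 * (y - (b + w)) * (y + w)) := by ring
    rw [h1, norm_neg, norm_mul, norm_mul, Complex.norm_ofNat]
    have h2 : ‖y + w‖ ≤ M' + W := (norm_add_le _ _).trans (add_le_add hyM hwW)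
    gcongr
  rw [hden]
  have hsplit : (Complex.exp (-t) - 1) * (s - n * f) - 2 * w * (b + w) =
      ((Complex.exp (-t) - 1) * (s - n * f) + P) - (P - (2 * b * y - 2 * y ^ 2)) -
        (2 * b * y - 2 * y ^ 2 + 2 * w * (b + w)) := by ring
  rw [hsplit]
  refine (norm_sub_le _ _).trans ((add_le_add (norm_sub_le _ _) le_rfl).trans ?_)
  refine (add_le_add (add_le_add hD1 hP1) hD2).trans_eq ?_
  rw [hC₄]
  ring

/-- At a zero, Xⁿ may be replaced by Zˢ, so Zˢ factors out of the derivative and later cancels the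
Zˢ in N(Z). -/
theorem deriv_factor_eq {Z X X' : ℂ} {n s : ℕ} (hn : n ≠ 0) (hs : s ≠ 0) (hZ : Z ≠ 0) (hX : X ≠ 0)
    (h : Z ^ s = X ^ n) :
    s * Z ^ (s - 1) - n * X ^ (n - 1) * X' = Z ^ s * (s / Z - n * X' / X) := by
  obtain ⟨m, rfl⟩ := Nat.exists_eq_succ_of_ne_zero hn
  obtain ⟨l, rfl⟩ := Nat.exists_eq_succ_of_ne_zero hs
  have h1 : Z ^ (l + 1) * (((l + 1 : ℕ) : ℂ) / Z) = ((l + 1 : ℕ) : ℂ) * Z ^ l := by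
    rw [pow_succ]
    field_simp
  have h2 : X ^ (m + 1) * (((m + 1 : ℕ) : ℂ) * X' / X) = ((m + 1 : ℕ) : ℂ) * X ^ m * X' := by
    rw [pow_succ]
    field_simp
  simp only [Nat.succ_eq_add_one, Nat.add_sub_cancel] at h ⊢
  rw [mul_sub, h1, h, h2]

theorem proposition4p7 (p : PMF ℕ) (hr : 1 < pgfRadius p)
    (hmax : ∀ r₁ : ℝ, 0 < r₁ → ENNReal.ofReal r₁ < pgfRadius p →
      ∀ z : ℂ, ‖z‖ = r₁ → z ≠ (r₁ : ℂ) → ‖pgf p z‖ < (pgf p (r₁ : ℂ)).re)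
    (γ₁ γ₂ : ℝ) (hγ₁ : 0 < γ₁) (K : ℕ) :
    ∃ C : ℝ, ∃ s₀ : ℕ, ∀ s n : ℕ, s₀ ≤ s →
      ∀ γ : ℝ, γ₁ ≤ γ → γ ≤ γ₂ → (n : ℝ) * lawMean p / (s : ℝ) = 1 - γ / √(s : ℝ) →
      ∀ q : PMF ℕ, IsStationaryLaw p n s q →
      ∀ Q : ℂ → ℂ, IsMeromorphicContinuation q (pgfRadius p) Q →
      ∀ Z₀ : ℝ, IsLeast {x : ℝ | ∃ w : ℂ, IsOuterZero p n s w ∧ ‖w‖ = x} Z₀ →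
      ∀ ε : ℝ, 0 < ε → 1 + ε < Z₀ →
      ∀ k : ℤ, |k| ≤ (K : ℤ) → ∀ Z : ℂ, IsOuterZeroOfIndex p n s k Z →
      ∃ E : ℂ, ‖E‖ ≤ C * (s : ℝ) ^ (-(1 / 2) : ℝ) ∧
        residueAt Q Z / (1 - Z) =
          Complex.exp (contourI p n s ε Z - contourI p n s ε 1) /
            (2 * rootK p γ k * ((bZero p γ : ℂ) + rootK p γ k)) * (1 + E) := by
  by_cases hγ₁₂ : γ₁ ≤ γ₂
  swap
  · exact ⟨0, 0, fun s n _ γ h1 h2 => absurd (h1.trans h2) hγ₁₂⟩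
  obtain ⟨C, b₁, s₀, hC, hb₁, H⟩ := exists_outerZero_estimate hr (lawMean_pos hr hmax)
    (lawVariance_pos hr hmax) hγ₁ hγ₁₂ K
  refine ⟨C / b₁ ^ 2, s₀, ?_⟩
  intro s n hs γ hγ hγ' heq q hq Q hQ Z₀ hZ₀ ε hε hεZ k hk Z hZ
  obtain ⟨hsq, hCs, hn, hdrift, hb, H⟩ := H s n hs γ hγ hγ' heq
  obtain ⟨hX, hest⟩ := H k hk Z hZ
  have hs0 : s ≠ 0 := by
    rintro rfl
    simp at hsq
  set w := rootK p γ k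
  set b := bZero p γ
  set L : ℂ := 2 * w * ((b : ℂ) + w) with hL
  set D : ℂ := (1 - Z) * (s / Z - n * deriv (pgf p) Z / pgf p Z) with hD
  have hb0 : 0 < b := hb₁.trans_le hb
  have hwre : b ≤ w.re := bZero_le_re_rootK p γ k
  have hw1 : b₁ ≤ ‖w‖ := hb.trans (hwre.trans (Complex.re_le_norm w))
  have hw2 : b₁ ≤ ‖(b : ℂ) + w‖ := by
    refine le_trans ?_ (Complex.re_le_norm _)
    simp
    linarith
  have hLn : 2 * b₁ ^ 2 ≤ ‖L‖ := by
    rw [hL, norm_mul, norm_mul, Complex.norm_ofNat]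
    nlinarith
  -- |L| ≥ 2b₁² and the error is at most b₁², so D is bounded away from 0. This makes the zero
  -- simple and the relative error O(s^(-1/2)).
  have hDn : b₁ ^ 2 ≤ ‖D‖ := by
    have h1 := norm_sub_norm_le L D
    rw [norm_sub_rev] at h1
    linarith
  have hb2 : 0 < b₁ ^ 2 := by positivity
  have hL0 : L ≠ 0 := norm_pos_iff.1 (by linarith)
  have hD0 : D ≠ 0 := norm_pos_iff.1 (by linarith)
  have hZ0 : Z ≠ 0 := by
    rintro rfl
    have := hZ.1.1.1
    simp at this
    linarith
  have hZ1 : 1 - Z ≠ 0 := left_ne_zero_of_mul hD0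
  have hpow : Z ^ s = pgf p Z ^ n := sub_eq_zero.1 (isOuterZero_iff.1 hZ.1.1).2.2
  have hfac := deriv_factor_eq (X' := deriv (pgf p) Z) hn hs0 hZ0 hX hpow
  have hR0 : (s : ℂ) / Z - n * deriv (pgf p) Z / pgf p Z ≠ 0 := right_ne_zero_of_mul hD0
  have hZs : Z ^ s ≠ 0 := pow_ne_zero s hZ0
  have hres := residueAt_outerZero hr hmax hn hdrift hq hQ hZ₀ hε hεZ hZ.1.1
    (by rw [hfac]; exact mul_ne_zero hZs hR0)
  refine ⟨L / D - 1, ?_, ?_⟩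
  · have h1 : L / D - 1 = -(D - L) / D := by
      field_simp
      ring
    have h2 : (s : ℝ) ^ (-(1 / 2) : ℝ) = 1 / √(s : ℝ) := by
      rw [Real.rpow_neg s.cast_nonneg, Real.sqrt_eq_rpow, one_div ((s : ℝ) ^ (1 / 2 : ℝ))]
    rw [h1, norm_div, norm_neg, h2, div_le_iff₀ (by linarith)]
    have h3 : 0 ≤ C / √(s : ℝ) := by positivity
    calc ‖D - L‖ ≤ C / √(s : ℝ) := hest
      _ = C / √(s : ℝ) / b₁ ^ 2 * b₁ ^ 2 := by field_simp
      _ ≤ C / √(s : ℝ) / b₁ ^ 2 * ‖D‖ := by gcongr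
      _ = _ := by ring
  · rw [hres, hfac, add_sub_cancel, div_mul_div_cancel₀ hL0, hD, mul_div_mul_left _ _ hZs,
      div_div, mul_comm (1 - Z)]
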